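/- Let $F$ be a non-archimedean local field with ring of integers $\mathcal O$, uniformizer $\varpi$, residue field of cardinality $q$, and normalized absolute value $|\cdot|$ (so $|\varpi|=q^{-1}$), and let $K=\mathrm{GL}_2(\mathcal O)$. Let $dx$, $d^\times x$, $dk$ be the Haar measures on $F$, $F^\times$, $K$ giving $\mathcal O$, $\mathcal O^\times$, $K$ volume $1$. Let $\psi$ be an unramified additive character of $F$, i.e. $\mathcal O$ is the largest fractional ideal on which $\psi$ is trivial. A quasi-character of $F^\times$ is unramified if it is trivial on $\mathcal O^\times$. For $i=1,2$ let $\pi_i$ be a spherical representation of $\mathrm{GL}_2(F)$, i.e. an irreducible smooth complex representation with a nonzero $K$-fixed vector, and let $\chi_i,\chi_i'$ be unramified quasi-characters such that $\pi_i$ is a constituent (subquotient) of the normalized induced representation $\mathrm{Ind}(\chi_i\otimes\chi_i')$. For an unramified quasi-character $\mu$ put $$L(s,\pi_i,\mu)=\frac{1}{(1-\chi_i(\varpi)\mu(\varpi)q^{-s})(1-\chi_i'(\varpi)\mu(\varpi)q^{-s})}.$$ Suppose that the central characters satisfy $\omega_{\pi_1}\omega_{\pi_2}=1$. Let $W_i\in\mathcal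 W(\pi_i,\psi)$ be the normalized $K$-fixed vector of the Whittaker model: $W_i(g)=\lambda_i(\pi_i(g)v_i)$ for some $v_i$ in the space of $\pi_i$ and some nonzero linear functional $\lambda_i$ with $\lambda_i\left(\pi_i\begin{pmatrix}1&x\\&1\end{pmatrix}v\right)=\psi(x)\lambda_i(v)$ for all $x\in F$ and all $v$; moreover $W_i(gk)=W_i(g)$ for $k\in K$, and $W_i(1)=1$. Let $f$ be the characteristic function of $\mathrm M_2(\mathcal O)\times \mathrm M_2(\mathcal O)$. For an unramified quasi-character $\mu$ and $s_1,s_2\in\mathbb C$ set $$\begin{aligned}\mathcal Z(W_1,W_2,f;\mu,|\cdot|^{s_1},|\cdot|^{s_2})=\int_{F^2}\int_{F^\times}\int_{K^2}& f\left(k_1^{-1}\begin{pmatrix}\epsilon^{-1}&\epsilon^{-1}v\\0&0\end{pmatrix}k_2,\;k_1^{-1}\begin{pmatrix}0&-u\epsilon\\0&\epsilon\end{pmatrix}k_2\right)\omega_{\pi_2}(\epsilon)|\epsilon|^{2s_2-2}\\ &\cdot\left(\int_{F^\times}W_1\left(\begin{pmatrix}\alpha&\\&1\end{pmatrix}k_1\right)\psi(u\alpha)\mu(\alpha)|\alpha|^{s_1-\frac12}\,d^\times\alpha\right)\\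 &\cdot\left(\int_{F^\times}W_2\left(\begin{pmatrix}\beta&\\&1\end{pmatrix}k_2\right)\psi(v\beta)\mu^{-1}(\beta)|\beta|^{s_2-\frac12}\,d^\times\beta\right)dk_1\,dk_2\,d^\times\epsilon\,du\,dv.\end{aligned}$$ Then for all $s_1,s_2$ with $q^{\Re s_1}>\max(|\chi_1(\varpi)\mu(\varpi)|,|\chi_1'(\varpi)\mu(\varpi)|)$ and $q^{\Re s_2}>\max(|\chi_2(\varpi)\mu(\varpi)^{-1}|,|\chi_2'(\varpi)\mu(\varpi)^{-1}|)$ (in particular for $\Re s_1,\Re s_2$ large), the inner integrals (for all $k_1,k_2\in K$ and $u,v\in F$) and the outer integral converge absolutely, and $$\mathcal Z(W_1,W_2,f;\mu,|\cdot|^{s_1},|\cdot|^{s_2})=L(s_1,\pi_1,\mu)\,L(s_2,\pi_2,\mu^{-1}).$$ -/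

import Mathlib

open scoped MatrixGroups

noncomputable section

namespace LocalGL2

open ValuativeRel MeasureTheory Matrix

section Field

variable (F : Type*) [Field F] [ValuativeRel F] [TopologicalSpace F]
  [IsNonarchimedeanLocalField F]

/-- The cardinality `q` of the residue field. -/
def resCard : ℕ := Nat.card 𝓀[F]

theorem resCard_ne_zero : ((resCard F : ℕ) : NNReal) ≠ 0 := by
  have : resCard F ≠ 0 := Nat.card_pos.ne'
  exact_mod_cast this

variable {F}

/-- The normalized absolute value: `|ϖ| = q⁻¹` for a uniformizer `ϖ`. -/
def nabs (x : F) : ℝ :=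
  WithZeroMulInt.toNNReal (resCard_ne_zero F)
    (IsNonarchimedeanLocalField.valueGroupWithZeroIsoInt F (valuation F x))

/-- `|x|^s` for `x ∈ Fˣ` and a complex exponent `s`. -/
def nabsPow (x : Fˣ) (s : ℂ) : ℂ := ((nabs (x : F) : ℝ) : ℂ) ^ s

end Field

section Characters

variable {F : Type*} [Field F] [ValuativeRel F]

/-- `ϖ` is a uniformizer, i.e. a prime element of the ring of integers. -/
def IsUniformizer (ϖ : Fˣ) : Prop :=
  ∃ h : (ϖ : F) ∈ 𝒪[F], Irreducible (⟨ϖ, h⟩ : 𝒪[F])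

/-- The quasi-character `χ` of `Fˣ` is unramified: it is trivial on the units of `𝒪[F]`
(in particular it is continuous). -/
def IsUnramifiedChar (χ : Fˣ →* ℂˣ) : Prop :=
  ∀ x : Fˣ, valuation F (x : F) = 1 → χ x = 1

/-- The additive character `ψ` is unramified: `𝒪[F]` is the largest fractional ideal on which
it is trivial (in particular it is continuous and nontrivial). -/
def IsUnramifiedAddChar (ψ : AddChar F Circle) : Prop :=
  ∀ a : F, (∀ x ∈ 𝒪[F], ψ (a * x) = 1) ↔ a ∈ 𝒪[F]

end Characters

section Group

variable {F : Type*} [Field F]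

/-- The diagonal matrix `diag(a, d)`. -/
def diag (a d : Fˣ) : GL (Fin 2) F where
  val := !![(a : F), 0; 0, (d : F)]
  inv := !![((a⁻¹ : Fˣ) : F), 0; 0, ((d⁻¹ : Fˣ) : F)]
  val_inv := by ext i j; fin_cases i <;> fin_cases j <;> simp
  inv_val := by ext i j; fin_cases i <;> fin_cases j <;> simp

/-- The unipotent matrix `(1 x; 0 1)`. -/
def unip (x : F) : GL (Fin 2) F := GeneralLinearGroup.upperRightHom x

variable (F) [ValuativeRel F]

/-- The maximal compact subgroup `K = GL₂(𝒪)` of `GL₂(F)`. -/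
def maxCompact : Subgroup (GL (Fin 2) F) :=
  (GeneralLinearGroup.map (n := Fin 2) (𝒪[F]).subtype).range

/-- The set `M₂(𝒪)` of integral matrices. -/
def integralMatrices : Set (Matrix (Fin 2) (Fin 2) F) :=
  {M | ∀ i j, M i j ∈ 𝒪[F]}

/-- The characteristic function of `M₂(𝒪) × M₂(𝒪)`. -/
def charFun (p : Matrix (Fin 2) (Fin 2) F × Matrix (Fin 2) (Fin 2) F) : ℂ :=
  (integralMatrices F ×ˢ integralMatrices F).indicator 1 p

end Group

section Representations

variable {F : Type*} [Field F] [ValuativeRel F] [TopologicalSpace F]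
  {V : Type*} [AddCommGroup V] [Module ℂ V]

/-- A representation of `GL₂(F)` is smooth if every vector is fixed by an open subgroup. -/
def IsSmooth (π : Representation ℂ (GL (Fin 2) F) V) : Prop :=
  ∀ v : V, ∃ U : Subgroup (GL (Fin 2) F), IsOpen (U : Set (GL (Fin 2) F)) ∧
    ∀ u ∈ U, π u v = v

/-- A spherical representation: irreducible, smooth, with a nonzero `K`-fixed vector. -/
structure IsSpherical (π : Representation ℂ (GL (Fin 2) F) V) : Prop where
  irreducible : π.IsIrreducible
  smooth : IsSmooth π
  exists_fixed : ∃ v : V, v ≠ 0 ∧ ∀ k ∈ maxCompact F, π k v = v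

/-- `ω` is the central character of `π`. -/
def IsCentralChar (π : Representation ℂ (GL (Fin 2) F) V) (ω : Fˣ →* ℂˣ) : Prop :=
  ∀ (z : Fˣ) (v : V), π (GeneralLinearGroup.scalar (Fin 2) z) v = (ω z : ℂ) • v

/-- `l` is a `ψ`-Whittaker functional on `π`. -/
def IsWhittakerFunctional (π : Representation ℂ (GL (Fin 2) F) V) (ψ : AddChar F Circle)
    (l : V →ₗ[ℂ] ℂ) : Prop :=
  ∀ (x : F) (v : V), l (π (unip x) v) = (ψ x : ℂ) * l v

/-- The Whittaker model `𝒲(π, ψ)`: the functions `g ↦ l (π(g) v)`, for a nonzero `ψ`-Whittaker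
functional `l` and `v ∈ π`. -/
def whittakerModel (π : Representation ℂ (GL (Fin 2) F) V) (ψ : AddChar F Circle) :
    Set (GL (Fin 2) F → ℂ) :=
  {W | ∃ l : V →ₗ[ℂ] ℂ, l ≠ 0 ∧ IsWhittakerFunctional π ψ l ∧ ∃ v : V, W = fun g => l (π g v)}

/-- `W` is right `K`-invariant and normalized by `W(1) = 1`. -/
def IsNormalizedSpherical (W : GL (Fin 2) F → ℂ) : Prop :=
  (∀ g, ∀ k ∈ maxCompact F, W (g * k) = W g) ∧ W 1 = 1

variable [IsNonarchimedeanLocalField F]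

/-- The space of the normalized induced representation `Ind(χ₁ ⊗ χ₂)`: functions `φ` on `GL₂(F)`,
right invariant under some open subgroup, with
`φ((a b; 0 d) g) = χ₁(a) χ₂(d) |a/d|^{1/2} φ(g)`. -/
def indSpace (χ₁ χ₂ : Fˣ →* ℂˣ) : Submodule ℂ (GL (Fin 2) F → ℂ) where
  carrier := {φ |
    (∀ (x : F) (a d : Fˣ) (g : GL (Fin 2) F),
      φ (unip x * diag a d * g) = (χ₁ a : ℂ) * (χ₂ d : ℂ) * nabsPow (a / d) (1 / 2) * φ g) ∧
    ∃ U : Subgroup (GL (Fin 2) F), IsOpen (U : Set (GL (Fin 2) F)) ∧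
      ∀ u ∈ U, ∀ g, φ (g * u) = φ g}
  add_mem' := by
    rintro φ φ' ⟨h, U, hU, hφ⟩ ⟨h', U', hU', hφ'⟩
    refine ⟨fun x a d g => ?_, U ⊓ U', hU.inter hU', fun u hu g => ?_⟩
    · simp only [Pi.add_apply, h, h', mul_add]
    · simp only [Pi.add_apply, hφ u hu.1, hφ' u hu.2]
  zero_mem' := ⟨fun x a d g => by simp, ⊤, isOpen_univ, fun u _ g => rfl⟩
  smul_mem' := by
    rintro c φ ⟨h, U, hU, hφ⟩
    refine ⟨fun x a d g => ?_, U, hU, fun u hu g => ?_⟩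
    · simp only [Pi.smul_apply, h, smul_eq_mul]; ring
    · simp only [Pi.smul_apply, hφ u hu]

theorem indSpace_translate (χ₁ χ₂ : Fˣ →* ℂˣ) (h : GL (Fin 2) F) {φ : GL (Fin 2) F → ℂ}
    (hφ : φ ∈ indSpace χ₁ χ₂) : (fun g => φ (g * h)) ∈ indSpace χ₁ χ₂ := by
  obtain ⟨h1, U, hU, h2⟩ := hφ
  refine ⟨fun x a d g => ?_, U.comap (MulAut.conj h⁻¹).toMonoidHom, ?_, fun u hu g => ?_⟩
  · simp only [mul_assoc] at h1 ⊢
    exact h1 x a d (g * h)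
  · have hc : Continuous fun u : GL (Fin 2) F => h⁻¹ * u * h := by fun_prop
    have := hU.preimage hc
    convert this using 1
    ext u
    simp
  · have hu' : h⁻¹ * u * h ∈ U := by simpa using hu
    have := h2 _ hu' (g * h)
    simpa [mul_assoc] using this

/-- The normalized induced representation `Ind(χ₁ ⊗ χ₂)`, by right translation. -/
def ind (χ₁ χ₂ : Fˣ →* ℂˣ) : Representation ℂ (GL (Fin 2) F) (indSpace χ₁ χ₂) where
  toFun h :=
    { toFun := fun φ => ⟨fun g => φ.1 (g * h), indSpace_translate χ₁ χ₂ h φ.2⟩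
      map_add' := fun _ _ => rfl
      map_smul' := fun _ _ => rfl }
  map_one' := by ext φ g; simp
  map_mul' := fun h h' => by ext φ g; simp [mul_assoc]

/-- `π` is a constituent (subquotient) of `Ind(χ₁ ⊗ χ₂)`: the image under an intertwining map of
a subrepresentation. -/
def IsConstituentOfInd (π : Representation ℂ (GL (Fin 2) F) V) (χ₁ χ₂ : Fˣ →* ℂˣ) : Prop :=
  ∃ (N : Subrepresentation (ind χ₁ χ₂))
    (p : Representation.IntertwiningMap N.toRepresentation π), Function.Surjective p

/-- `(χ₁, χ₂)` are Satake parameters of the spherical representation `π`: unramified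
quasi-characters such that `π` is a constituent of `Ind(χ₁ ⊗ χ₂)`. -/
structure IsSatake (π : Representation ℂ (GL (Fin 2) F) V) (χ₁ χ₂ : Fˣ →* ℂˣ) : Prop where
  unramified₁ : IsUnramifiedChar χ₁
  unramified₂ : IsUnramifiedChar χ₂
  constituent : IsConstituentOfInd π χ₁ χ₂

end Representations

section Zeta

variable {F : Type*} [Field F] [ValuativeRel F] [TopologicalSpace F]
  [IsNonarchimedeanLocalField F]

/-- The factor `(1 - χ(ϖ) q^{-s})⁻¹` of an unramified quasi-character `χ`. -/
def tateL (ϖ : Fˣ) (χ : Fˣ →* ℂˣ) (s : ℂ) : ℂ :=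
  (1 - (χ ϖ : ℂ) * (resCard F : ℂ) ^ (-s))⁻¹

/-- The local factor `L(s, π, μ)` of the spherical representation `π` with Satake parameters
`(χ₁, χ₂)`, twisted by the unramified quasi-character `μ`. -/
def sphericalL (ϖ : Fˣ) (χ₁ χ₂ μ : Fˣ →* ℂˣ) (s : ℂ) : ℂ :=
  tateL ϖ (χ₁ * μ) s * tateL ϖ (χ₂ * μ) s

/-- The integrand of `innerZeta`. -/
def innerIntegrand (ψ : AddChar F Circle) (W : GL (Fin 2) F → ℂ) (k : GL (Fin 2) F) (u : F)
    (μ : Fˣ →* ℂˣ) (s : ℂ) (α : Fˣ) : ℂ :=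
  W (diag α 1 * k) * (ψ (u * α) : ℂ) * (μ α : ℂ) * nabsPow α (s - 1 / 2)

variable [MeasurableSpace F]

/-- `∫_{Fˣ} W(diag(α, 1) k) ψ(uα) μ(α) |α|^{s - 1/2} d^×α`. -/
def innerZeta (dt : Measure Fˣ) (ψ : AddChar F Circle) (W : GL (Fin 2) F → ℂ)
    (k : GL (Fin 2) F) (u : F) (μ : Fˣ →* ℂˣ) (s : ℂ) : ℂ :=
  ∫ α, innerIntegrand ψ W k u μ s α ∂dt

/-- The integrand of the two-variable zeta integral at `(u, v, ε, k₁, k₂)`. -/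
def zetaIntegrand (dt : Measure Fˣ) (ψ : AddChar F Circle) (W₁ W₂ : GL (Fin 2) F → ℂ)
    (f : Matrix (Fin 2) (Fin 2) F × Matrix (Fin 2) (Fin 2) F → ℂ) (ω₂ μ : Fˣ →* ℂˣ)
    (s₁ s₂ : ℂ) (p : F × F × Fˣ × maxCompact F × maxCompact F) : ℂ :=
  match p with
  | (u, v, ε, k₁, k₂) =>
    f (((k₁⁻¹ : maxCompact F) : GL (Fin 2) F).val *
          !![((ε⁻¹ : Fˣ) : F), ((ε⁻¹ : Fˣ) : F) * v; 0, 0] * (k₂ : GL (Fin 2) F).val,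
       ((k₁⁻¹ : maxCompact F) : GL (Fin 2) F).val *
          !![0, -(u * (ε : F)); 0, (ε : F)] * (k₂ : GL (Fin 2) F).val) *
      (ω₂ ε : ℂ) * nabsPow ε (2 * s₂ - 2) *
      innerZeta dt ψ W₁ k₁ u μ s₁ * innerZeta dt ψ W₂ k₂ v μ⁻¹ s₂

variable [MeasurableSpace (GL (Fin 2) F)]

/-- The product measure `du dv d^×ε dk₁ dk₂`. -/
def zetaMeasure (dx : Measure F) (dt : Measure Fˣ) (dk : Measure (maxCompact F)) :
    Measure (F × F × Fˣ × maxCompact F × maxCompact F) :=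
  dx.prod (dx.prod (dt.prod (dk.prod dk)))

/-- The two-variable zeta integral `𝒵(W₁, W₂, f; μ, |.|^{s₁}, |.|^{s₂})`, where `ω₂` is the central
character of the representation that `W₂` belongs to. -/
def zetaIntegral (dx : Measure F) (dt : Measure Fˣ) (dk : Measure (maxCompact F))
    (ψ : AddChar F Circle) (W₁ W₂ : GL (Fin 2) F → ℂ)
    (f : Matrix (Fin 2) (Fin 2) F × Matrix (Fin 2) (Fin 2) F → ℂ) (ω₂ μ : Fˣ →* ℂˣ)
    (s₁ s₂ : ℂ) : ℂ :=
  ∫ p, zetaIntegrand dt ψ W₁ W₂ f ω₂ μ s₁ s₂ p ∂(zetaMeasure dx dt dk)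

/-- All the integrals in the definition of `zetaIntegral` converge absolutely. -/
def ZetaConverges (dx : Measure F) (dt : Measure Fˣ) (dk : Measure (maxCompact F))
    (ψ : AddChar F Circle) (W₁ W₂ : GL (Fin 2) F → ℂ)
    (f : Matrix (Fin 2) (Fin 2) F × Matrix (Fin 2) (Fin 2) F → ℂ) (ω₂ μ : Fˣ →* ℂˣ)
    (s₁ s₂ : ℂ) : Prop :=
  (∀ k ∈ maxCompact F, ∀ u : F, Integrable (innerIntegrand ψ W₁ k u μ s₁) dt) ∧
  (∀ k ∈ maxCompact F, ∀ v : F, Integrable (innerIntegrand ψ W₂ k v μ⁻¹ s₂) dt) ∧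
  Integrable (zetaIntegrand dt ψ W₁ W₂ f ω₂ μ s₁ s₂) (zetaMeasure dx dt dk)

end Zeta

end LocalGL2

end

open LocalGL2 ValuativeRel MeasureTheory

/-!
Conjugation by `K` preserves `M₂(𝒪)`, so the value of `f` in the zeta integral is that at
`k₁ = k₂ = 1`: it is `1` if `u, v ∈ 𝒪` and `ε ∈ 𝒪ˣ`, and `0` otherwise. On that set, of volume `1`,
the inner integrals do not depend on `u`, `v`, `k₁`, `k₂`, since `W (diag(α, 1))` vanishes unless
`α ∈ 𝒪`. It remains to see that they are the two `L`-factors.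

The representation `π` is a quotient of a smooth subrepresentation of `Ind(χ ⊗ χ')`. Averaging over
`K` shows that `W` comes from a `K`-fixed vector of that subrepresentation, and by the Iwasawa
decomposition such a vector is an eigenvector of the Hecke operator of `K diag(ϖ, 1) K`, with
eigenvalue `q^{1/2} (χ(ϖ) + χ'(ϖ))`. For `w n = q^{n/2} W (diag(ϖ^n, 1))` this says
`w (n + 2) = (χ(ϖ) + χ'(ϖ)) w (n + 1) - χ(ϖ) χ'(ϖ) w n`, so `w n` is the complete homogeneous
symmetric polynomial of degree `n` in `χ(ϖ)`, `χ'(ϖ)`, and these are the coefficients of the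
`L`-factor as a power series in `μ(ϖ) q^{-s}`.
-/

noncomputable section

namespace LocalGL2

open Matrix

section Order

variable {F : Type*} [Field F] [ValuativeRel F]

theorem isUnit_integer_iff (a : 𝒪[F]) : IsUnit a ↔ valuation F (a : F) = 1 :=
  Valuation.Integers.isUnit_iff_valuation_eq_one (Valuation.integer.integers _)

variable [TopologicalSpace F] [IsNonarchimedeanLocalField F]

/-- The normalized additive valuation on `Fˣ`, which is `1` on uniformizers. -/
def ord (x : Fˣ) : ℤ :=
  -WithZero.log (IsNonarchimedeanLocalField.valueGroupWithZeroIsoInt F (valuation F (x : F)))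

theorem valueGroupWithZeroIsoInt_valuation (x : Fˣ) :
    IsNonarchimedeanLocalField.valueGroupWithZeroIsoInt F (valuation F (x : F)) =
      WithZero.exp (-ord x) := by
  rw [ord, neg_neg, WithZero.exp_log (by simp)]

theorem ord_one : ord (1 : Fˣ) = 0 := by
  simp [ord]

theorem ord_mul (x y : Fˣ) : ord (x * y) = ord x + ord y := by
  simp only [ord, Units.val_mul, map_mul]
  rw [WithZero.log_mul (by simp) (by simp), neg_add]

theorem ord_zpow (x : Fˣ) (n : ℤ) : ord (x ^ n) = n * ord x := by
  simp [ord, WithZero.log_zpow]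

theorem ord_inv (x : Fˣ) : ord x⁻¹ = -ord x := by
  simpa using ord_zpow x (-1)

theorem ord_surjective : Function.Surjective (ord : Fˣ → ℤ) := by
  intro n
  obtain ⟨y, hy⟩ := valuation_surjective (K := F)
    ((IsNonarchimedeanLocalField.valueGroupWithZeroIsoInt F).symm (WithZero.exp (-n)))
  have hy0 : y ≠ 0 := by
    rintro rfl
    rw [map_zero, eq_comm, map_eq_zero] at hy
    exact WithZero.exp_ne_zero hy
  exact ⟨Units.mk0 y hy0, by simp [ord, hy]⟩

theorem valuation_le_valuation_iff (x y : Fˣ) :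
    valuation F (x : F) ≤ valuation F (y : F) ↔ ord y ≤ ord x := by
  rw [← (IsNonarchimedeanLocalField.valueGroupWithZeroIsoInt F).strictMono.le_iff_le,
    valueGroupWithZeroIsoInt_valuation, valueGroupWithZeroIsoInt_valuation,
    WithZero.exp_le_exp, neg_le_neg_iff]

theorem valuation_eq_valuation_iff (x y : Fˣ) :
    valuation F (x : F) = valuation F (y : F) ↔ ord x = ord y := by
  rw [le_antisymm_iff, valuation_le_valuation_iff, valuation_le_valuation_iff, and_comm,
    ← le_antisymm_iff]

theorem valuation_le_one_iff (x : Fˣ) : valuation F (x : F) ≤ 1 ↔ 0 ≤ ord x := by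
  simpa [ord_one] using valuation_le_valuation_iff x 1

theorem valuation_eq_one_iff (x : Fˣ) : valuation F (x : F) = 1 ↔ ord x = 0 := by
  simpa [ord_one] using valuation_eq_valuation_iff x 1

theorem ord_uniformizer {ϖ : Fˣ} (hϖ : IsUniformizer ϖ) : ord ϖ = 1 := by
  obtain ⟨hϖ_mem, hϖ_irr⟩ := hϖ
  have hϖ_nonneg : 0 ≤ ord ϖ := (valuation_le_one_iff ϖ).1 hϖ_mem
  have hϖ_ne : ord ϖ ≠ 0 := fun h =>
    hϖ_irr.not_isUnit ((isUnit_integer_iff _).2 ((valuation_eq_one_iff ϖ).2 h))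
  obtain ⟨y, hy⟩ := ord_surjective (F := F) 1
  have hz : ord (ϖ / y) = ord ϖ - 1 := by rw [div_eq_mul_inv, ord_mul, ord_inv, hy]; rfl
  have hy_mem : (y : F) ∈ 𝒪[F] := (valuation_le_one_iff y).2 (by omega)
  have hz_mem : ((ϖ / y : Fˣ) : F) ∈ 𝒪[F] := (valuation_le_one_iff _).2 (by omega)
  have hmul : (⟨ϖ, hϖ_mem⟩ : 𝒪[F]) = ⟨y, hy_mem⟩ * ⟨_, hz_mem⟩ :=
    Subtype.ext (by simp [mul_div_cancel₀])
  rcases hϖ_irr.isUnit_or_isUnit hmul with h | h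
  · have := (valuation_eq_one_iff y).1 ((isUnit_integer_iff _).1 h)
    omega
  · have := (valuation_eq_one_iff (ϖ / y)).1 ((isUnit_integer_iff _).1 h)
    omega

theorem IsUnramifiedChar.eq_zpow_ord {χ : Fˣ →* ℂˣ} (hχ : IsUnramifiedChar χ) {ϖ : Fˣ}
    (hϖ : IsUniformizer ϖ) (x : Fˣ) : χ x = χ ϖ ^ ord x := by
  have hunit : χ (x / ϖ ^ ord x) = 1 := by
    refine hχ _ ((valuation_eq_one_iff _).2 ?_)
    rw [div_eq_mul_inv, ord_mul, ord_inv, ord_zpow, ord_uniformizer hϖ]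
    ring
  rwa [map_div, map_zpow, div_eq_one] at hunit

theorem IsUnramifiedChar.inv {F : Type*} [Field F] [ValuativeRel F] {χ : Fˣ →* ℂˣ}
    (hχ : IsUnramifiedChar χ) : IsUnramifiedChar χ⁻¹ := fun x hx => by
  rw [MonoidHom.inv_apply, hχ x hx, inv_one]

end Order

section AbsoluteValue

variable {F : Type*} [Field F] [ValuativeRel F] [TopologicalSpace F]
  [IsNonarchimedeanLocalField F]

theorem one_lt_resCard : 1 < resCard F := Finite.one_lt_card

theorem natCast_resCard_ne_zero : (resCard F : ℂ) ≠ 0 :=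
  Nat.cast_ne_zero.2 (zero_lt_one.trans one_lt_resCard).ne'

theorem nabs_eq_zpow (x : Fˣ) : nabs (x : F) = (resCard F : ℝ) ^ (-ord x) := by
  rw [nabs, valueGroupWithZeroIsoInt_valuation,
    WithZeroMulInt.toNNReal_neg_apply _ WithZero.exp_ne_zero]
  simp only [NNReal.coe_zpow, NNReal.coe_natCast]
  rfl

theorem nabsPow_eq_zpow (x : Fˣ) (s : ℂ) : nabsPow x s = ((resCard F : ℂ) ^ (-s)) ^ ord x := by
  have hq : (0 : ℝ) < resCard F := Nat.cast_pos.2 (zero_lt_one.trans one_lt_resCard)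
  have habs : 0 < (resCard F : ℝ) ^ (-ord x) := zpow_pos hq _
  rw [nabsPow, nabs_eq_zpow, Complex.cpow_def_of_ne_zero (Complex.ofReal_ne_zero.2 habs.ne'),
    Complex.cpow_def_of_ne_zero natCast_resCard_ne_zero, ← Complex.ofReal_log habs.le,
    Real.log_zpow, ← Complex.exp_int_mul, ← Complex.natCast_log]
  push_cast
  ring_nf

theorem nabsPow_uniformizer {ϖ : Fˣ} (hϖ : IsUniformizer ϖ) (s : ℂ) :
    nabsPow ϖ s = (resCard F : ℂ) ^ (-s) := by
  rw [nabsPow_eq_zpow, ord_uniformizer hϖ, zpow_one]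

theorem cpow_half_mul_self (z : ℂ) : z ^ (1 / 2 : ℂ) * z ^ (1 / 2 : ℂ) = z := by
  rw [← sq, ← Complex.cpow_mul_nat]
  norm_num

theorem mul_cpow_neg_half (z : ℂ) : z * z ^ (-(1 / 2) : ℂ) = z ^ (1 / 2 : ℂ) := by
  rw [Complex.cpow_neg]
  nth_rw 1 [← cpow_half_mul_self z]
  exact mul_self_mul_inv _

theorem nabsPow_sub_half (x : Fˣ) (s : ℂ) :
    nabsPow x (s - 1 / 2) = nabsPow x s * ((resCard F : ℂ) ^ (1 / 2 : ℂ)) ^ ord x := by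
  rw [nabsPow_eq_zpow, nabsPow_eq_zpow, ← mul_zpow, ← Complex.cpow_add _ _ natCast_resCard_ne_zero]
  ring_nf

end AbsoluteValue

section MatrixGroup

variable {F : Type*} [Field F]

theorem unip_val (x : F) : (unip x).val = !![1, x; 0, 1] := by
  simp [unip]

theorem diag_val (a d : Fˣ) : (diag a d).val = !![(a : F), 0; 0, (d : F)] := rfl

theorem diag_mul (a d a' d' : Fˣ) : diag a d * diag a' d' = diag (a * a') (d * d') := by
  ext i j
  fin_cases i <;> fin_cases j <;> simp [diag_val]

theorem diag_one : diag (1 : Fˣ) 1 = 1 := by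
  ext i j
  fin_cases i <;> fin_cases j <;> simp [diag_val]

theorem unip_zero : unip (0 : F) = 1 := by
  ext i j
  fin_cases i <;> fin_cases j <;> simp [unip_val]

theorem diag_mul_unip (a : Fˣ) (x : F) : diag a 1 * unip x = unip (a * x) * diag a 1 := by
  ext i j
  fin_cases i <;> fin_cases j <;> simp [unip_val, diag_val]

theorem scalar_eq_diag (a : Fˣ) : GeneralLinearGroup.scalar (Fin 2) a = diag a a := by
  ext i j
  fin_cases i <;> fin_cases j <;> simp [diag_val]

theorem exists_eq_unip_mul_diag {g : GL (Fin 2) F} (hg : g.val 1 0 = 0) :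
    ∃ (x : F) (a d : Fˣ), g = unip x * diag a d := by
  have hdet : g.val.det ≠ 0 := ((Matrix.isUnit_iff_isUnit_det _).1 g.isUnit).ne_zero
  rw [Matrix.det_fin_two, hg, mul_zero, sub_zero] at hdet
  have ha := left_ne_zero_of_mul hdet
  have hd := right_ne_zero_of_mul hdet
  refine ⟨g.val 0 1 / g.val 1 1, Units.mk0 _ ha, Units.mk0 _ hd, ?_⟩
  ext i j
  fin_cases i <;> fin_cases j <;> simp [unip_val, diag_val, hg, hd]

variable [ValuativeRel F]

theorem of_mem_integralMatrices_iff (a b c d : F) :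
    !![a, b; c, d] ∈ integralMatrices F ↔ (a ∈ 𝒪[F] ∧ b ∈ 𝒪[F]) ∧ c ∈ 𝒪[F] ∧ d ∈ 𝒪[F] := by
  simp [integralMatrices, Fin.forall_fin_two]

theorem mul_mem_integralMatrices {A B : Matrix (Fin 2) (Fin 2) F} (hA : A ∈ integralMatrices F)
    (hB : B ∈ integralMatrices F) : A * B ∈ integralMatrices F := by
  intro i j
  rw [Matrix.mul_apply]
  exact sum_mem fun k _ => mul_mem (hA i k) (hB k j)

theorem mem_maxCompact_iff (g : GL (Fin 2) F) :
    g ∈ maxCompact F ↔ g.val ∈ integralMatrices F ∧ valuation F g.val.det = 1 := by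
  constructor
  · rintro ⟨k, rfl⟩
    have hdet : (GeneralLinearGroup.map (n := Fin 2) (𝒪[F]).subtype k).val.det =
        ((k.val.det : 𝒪[F]) : F) := by
      simp [Matrix.det_fin_two]
    refine ⟨fun i j => (k.val i j).2, ?_⟩
    rw [hdet]
    exact (isUnit_integer_iff _).1 ((Matrix.isUnit_iff_isUnit_det _).1 k.isUnit)
  · rintro ⟨hg, hdet⟩
    let A : Matrix (Fin 2) (Fin 2) 𝒪[F] := fun i j => ⟨g.val i j, hg i j⟩
    have hA : ((A.det : 𝒪[F]) : F) = g.val.det := by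
      rw [Matrix.det_fin_two, Matrix.det_fin_two]
      rfl
    refine ⟨GeneralLinearGroup.mk'' A ((isUnit_integer_iff _).2 (hA ▸ hdet)), ?_⟩
    ext i j
    rfl

theorem conj_mem_integralMatrices_iff {k k' : GL (Fin 2) F} (hk : k ∈ maxCompact F)
    (hk' : k' ∈ maxCompact F) (A : Matrix (Fin 2) (Fin 2) F) :
    k.val * A * k'.val ∈ integralMatrices F ↔ A ∈ integralMatrices F := by
  have mul_mem_mul {k k' : GL (Fin 2) F} (hk : k ∈ maxCompact F) (hk' : k' ∈ maxCompact F)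
      {A : Matrix (Fin 2) (Fin 2) F} (hA : A ∈ integralMatrices F) :
      k.val * A * k'.val ∈ integralMatrices F :=
    mul_mem_integralMatrices (mul_mem_integralMatrices ((mem_maxCompact_iff k).1 hk).1 hA)
      ((mem_maxCompact_iff k').1 hk').1
  refine ⟨fun h => ?_, mul_mem_mul hk hk'⟩
  have hcancel : (k⁻¹).val * (k.val * A * k'.val) * (k'⁻¹).val = A := by
    rw [Matrix.mul_assoc, Matrix.mul_assoc, Matrix.mul_assoc, Units.mul_inv, Matrix.mul_one,
      ← Matrix.mul_assoc, Units.inv_mul, Matrix.one_mul]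
  exact hcancel ▸ mul_mem_mul (inv_mem hk) (inv_mem hk') h

theorem unip_mem_maxCompact {x : F} (hx : x ∈ 𝒪[F]) : unip x ∈ maxCompact F := by
  rw [mem_maxCompact_iff, unip_val, of_mem_integralMatrices_iff, Matrix.det_fin_two_of]
  simp [hx, zero_mem, one_mem]

theorem diag_mem_maxCompact {a d : Fˣ} (ha : valuation F (a : F) = 1)
    (hd : valuation F (d : F) = 1) : diag a d ∈ maxCompact F := by
  rw [mem_maxCompact_iff, diag_val, of_mem_integralMatrices_iff, Matrix.det_fin_two_of]
  simp [Valuation.mem_integer_iff, ha, hd]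

theorem exists_mem_maxCompact_val_eq {A : Matrix (Fin 2) (Fin 2) F}
    (hA : A ∈ integralMatrices F) (hdet : valuation F A.det = 1) :
    ∃ k ∈ maxCompact F, k.val = A := by
  have hdet_ne : A.det ≠ 0 := fun h => by simp [h] at hdet
  exact ⟨GeneralLinearGroup.mk'' A hdet_ne.isUnit, (mem_maxCompact_iff _).2 ⟨hA, hdet⟩, rfl⟩

theorem exists_mem_integer_mul_eq {c d : F} (h : valuation F c ≤ valuation F d) :
    ∃ t ∈ 𝒪[F], d * t = c := by
  refine ⟨c / d, ?_, mul_div_cancel_of_imp' ?_⟩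
  · rw [Valuation.mem_integer_iff, map_div₀]
    exact div_le_one_of_le₀ h zero_le
  · rintro rfl
    simpa using h

theorem exists_mem_maxCompact_mul_add_mul_eq_zero (c d : F) :
    ∃ k ∈ maxCompact F, c * k.val 0 0 + d * k.val 1 0 = 0 := by
  rcases le_total (valuation F c) (valuation F d) with h | h
  · obtain ⟨t, ht, rfl⟩ := exists_mem_integer_mul_eq h
    obtain ⟨k, hk, hkv⟩ := exists_mem_maxCompact_val_eq (A := !![1, 0; -t, 1])
      (by simp [of_mem_integralMatrices_iff, zero_mem, one_mem, ht]) (by simp)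
    exact ⟨k, hk, by simp [hkv]⟩
  · obtain ⟨t, ht, rfl⟩ := exists_mem_integer_mul_eq h
    obtain ⟨k, hk, hkv⟩ := exists_mem_maxCompact_val_eq (A := !![-t, 1; 1, 0])
      (by simp [of_mem_integralMatrices_iff, zero_mem, one_mem, ht]) (by simp)
    exact ⟨k, hk, by simp [hkv]⟩

theorem exists_iwasawa (g : GL (Fin 2) F) :
    ∃ (x : F) (a d : Fˣ), ∃ k ∈ maxCompact F, g = unip x * diag a d * k := by
  obtain ⟨k, hk, h⟩ := exists_mem_maxCompact_mul_add_mul_eq_zero (g.val 1 0) (g.val 1 1)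
  have hgk : (g * k).val 1 0 = 0 := by
    rw [Units.val_mul, Matrix.mul_apply, Fin.sum_univ_two, h]
  obtain ⟨x, a, d, hxad⟩ := exists_eq_unip_mul_diag hgk
  exact ⟨x, a, d, k⁻¹, inv_mem hk, by rw [← hxad, mul_inv_cancel_right]⟩

end MatrixGroup

section Hecke

theorem eq_zero_or_exists_eq_mul_of_mul_eq_mul {k : Type*} [Field k] {a b c d : k}
    (h : a * d = b * c) : (c = 0 ∧ d = 0) ∨ ∃ y, a = y * c ∧ b = y * d := by
  by_cases hc : c = 0
  · by_cases hd : d = 0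
    · exact .inl ⟨hc, hd⟩
    · exact .inr ⟨b / d, by rw [div_mul_eq_mul_div, eq_div_iff hd, h], by field_simp⟩
  · exact .inr ⟨a / c, by field_simp, by rw [div_mul_eq_mul_div, eq_div_iff hc, h]⟩

variable {F : Type*} [Field F] [ValuativeRel F]

/-- A representative in `𝒪` of a residue class. -/
def resLift (b : 𝓀[F]) : 𝒪[F] := Function.surjInv IsLocalRing.residue_surjective b

theorem residue_resLift (b : 𝓀[F]) : IsLocalRing.residue 𝒪[F] (resLift b) = b :=
  Function.surjInv_eq _ b

/-- Representatives of the left cosets of `K` in `K diag(ϖ, 1) K`, indexed by `ℙ¹` of the residue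
field, with `none` as the point at infinity. -/
def heckeRep (ϖ : Fˣ) : Option 𝓀[F] → GL (Fin 2) F
  | none => diag 1 ϖ
  | some b => unip (resLift b : F) * diag ϖ 1

theorem heckeRep_none_val (ϖ : Fˣ) : (heckeRep ϖ none).val = !![1, 0; 0, (ϖ : F)] := rfl

theorem heckeRep_some_val (ϖ : Fˣ) (b : 𝓀[F]) :
    (heckeRep ϖ (some b)).val = !![(ϖ : F), (resLift b : F); 0, 1] := by
  simp [heckeRep, unip_val, diag_val]

theorem det_heckeRep (ϖ : Fˣ) (x : Option 𝓀[F]) : (heckeRep ϖ x).val.det = ϖ := by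
  cases x <;> simp [heckeRep_none_val, heckeRep_some_val, Matrix.det_fin_two]

theorem heckeRep_val_mem_integralMatrices {ϖ : Fˣ} (hϖ : IsUniformizer ϖ) (x : Option 𝓀[F]) :
    (heckeRep ϖ x).val ∈ integralMatrices F := by
  obtain ⟨hϖ_mem, -⟩ := hϖ
  cases x <;> simp [heckeRep_none_val, heckeRep_some_val, of_mem_integralMatrices_iff,
    zero_mem, one_mem, hϖ_mem]

variable [TopologicalSpace F] [IsNonarchimedeanLocalField F] {ϖ : Fˣ}

theorem residue_eq_zero_iff (hϖ : IsUniformizer ϖ) (a : 𝒪[F]) :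
    IsLocalRing.residue 𝒪[F] a = 0 ↔ ∃ c : 𝒪[F], (a : F) = ϖ * c := by
  obtain ⟨hϖ_mem, hϖ_irr⟩ := hϖ
  rw [IsLocalRing.residue_eq_zero_iff, hϖ_irr.maximalIdeal_eq, Ideal.mem_span_singleton]
  exact ⟨fun ⟨c, hc⟩ => ⟨c, congrArg Subtype.val hc⟩, fun ⟨c, hc⟩ => ⟨c, Subtype.ext hc⟩⟩

theorem uniformizer_mul_ne_one (hϖ : IsUniformizer ϖ) {x : F} (hx : x ∈ 𝒪[F]) :
    (ϖ : F) * x ≠ 1 := by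
  intro h
  have := (residue_eq_zero_iff hϖ 1).2 ⟨⟨x, hx⟩, h.symm⟩
  simp at this

theorem eq_of_heckeRep_mul_eq_heckeRep (hϖ : IsUniformizer ϖ) {x y : Option 𝓀[F]}
    {k : GL (Fin 2) F} (hk : k ∈ maxCompact F) (h : heckeRep ϖ x * k = heckeRep ϖ y) : x = y := by
  have hk_int := ((mem_maxCompact_iff k).1 hk).1
  have hval := congrArg Units.val h
  rw [Units.val_mul, Matrix.eta_fin_two k.val] at hval
  rcases x with _ | b <;> rcases y with _ | c <;>
    simp only [heckeRep_none_val, heckeRep_some_val, Matrix.mul_fin_two, zero_mul, one_mul,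
      zero_add, add_zero, EmbeddingLike.apply_eq_iff_eq, Matrix.vecCons_inj, and_true] at hval
  · rfl
  · exact absurd hval.2.2 (uniformizer_mul_ne_one hϖ (hk_int 1 1))
  · obtain ⟨⟨h00, -⟩, h10, -⟩ := hval
    rw [h10, mul_zero, add_zero] at h00
    exact absurd h00 (uniformizer_mul_ne_one hϖ (hk_int 0 0))
  · obtain ⟨⟨-, h01⟩, -, h11⟩ := hval
    rw [h11, mul_one] at h01
    have hcb := (residue_eq_zero_iff hϖ (resLift c - resLift b)).2
      ⟨⟨_, hk_int 0 1⟩, by push_cast; rw [← h01]; ring⟩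
    rw [map_sub, residue_resLift, residue_resLift, sub_eq_zero] at hcb
    rw [hcb]

theorem exists_eq_heckeRep_some_mul (hϖ : IsUniformizer ϖ) {a b c d : 𝒪[F]} {y : 𝓀[F]}
    (hac : IsLocalRing.residue 𝒪[F] a = y * IsLocalRing.residue 𝒪[F] c)
    (hbd : IsLocalRing.residue 𝒪[F] b = y * IsLocalRing.residue 𝒪[F] d) :
    ∃ A ∈ integralMatrices F, !![(a : F), b; c, d] = (heckeRep ϖ (some y)).val * A := by
  obtain ⟨a', ha'⟩ := (residue_eq_zero_iff hϖ (a - resLift y * c)).1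
    (by rw [map_sub, map_mul, residue_resLift, hac, sub_self])
  obtain ⟨b', hb'⟩ := (residue_eq_zero_iff hϖ (b - resLift y * d)).1
    (by rw [map_sub, map_mul, residue_resLift, hbd, sub_self])
  push_cast at ha' hb'
  refine ⟨!![(a' : F), b'; c, d], by simp [of_mem_integralMatrices_iff], ?_⟩
  simp [heckeRep_some_val, ← ha', ← hb']

theorem exists_eq_heckeRep_none_mul (hϖ : IsUniformizer ϖ) (a b : 𝒪[F]) {c d : 𝒪[F]}
    (hc : IsLocalRing.residue 𝒪[F] c = 0) (hd : IsLocalRing.residue 𝒪[F] d = 0) :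
    ∃ A ∈ integralMatrices F, !![(a : F), b; c, d] = (heckeRep ϖ none).val * A := by
  obtain ⟨c', hc'⟩ := (residue_eq_zero_iff hϖ c).1 hc
  obtain ⟨d', hd'⟩ := (residue_eq_zero_iff hϖ d).1 hd
  refine ⟨!![(a : F), b; c', d'], by simp [of_mem_integralMatrices_iff], ?_⟩
  simp [heckeRep_none_val, ← hc', ← hd']

theorem exists_eq_heckeRep_mul (hϖ : IsUniformizer ϖ) {g : GL (Fin 2) F}
    (hg : g.val ∈ integralMatrices F) (hdet : valuation F g.val.det = valuation F (ϖ : F)) :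
    ∃ x, ∃ k ∈ maxCompact F, g = heckeRep ϖ x * k := by
  have hϖ_val : valuation F (ϖ : F) ≠ 0 := by simp
  suffices h : ∃ x, ∃ A ∈ integralMatrices F, g.val = (heckeRep ϖ x).val * A by
    obtain ⟨x, A, hA, h⟩ := h
    rw [h, Matrix.det_mul, det_heckeRep, map_mul] at hdet
    obtain ⟨k, hk, hkA⟩ := exists_mem_maxCompact_val_eq hA (mul_eq_left₀ hϖ_val |>.1 hdet)
    exact ⟨x, k, hk, Units.ext (by rw [h, Units.val_mul, hkA])⟩
  obtain ⟨a, b, c, d, hval⟩ : ∃ a b c d : 𝒪[F], g.val = !![(a : F), b; c, d] :=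
    ⟨⟨_, hg 0 0⟩, ⟨_, hg 0 1⟩, ⟨_, hg 1 0⟩, ⟨_, hg 1 1⟩, Matrix.eta_fin_two _⟩
  rw [hval, Matrix.det_fin_two_of] at hdet
  rw [hval]
  obtain ⟨t, ht, hdet_eq⟩ := exists_mem_integer_mul_eq hdet.le
  have hres : IsLocalRing.residue 𝒪[F] (a * d - b * c) = 0 :=
    (residue_eq_zero_iff hϖ _).2 ⟨⟨t, ht⟩, hdet_eq.symm⟩
  rw [map_sub, map_mul, map_mul, sub_eq_zero] at hres
  rcases eq_zero_or_exists_eq_mul_of_mul_eq_mul hres with ⟨hc, hd⟩ | ⟨y, hac, hbd⟩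
  · exact ⟨none, exists_eq_heckeRep_none_mul hϖ a b hc hd⟩
  · exact ⟨some y, exists_eq_heckeRep_some_mul hϖ hac hbd⟩

instance : Fintype 𝓀[F] := Fintype.ofFinite _

variable {V E : Type*} [AddCommGroup V] [Module ℂ V] [AddCommGroup E] [Module ℂ E]
  {π : Representation ℂ (GL (Fin 2) F) V} {ρ : Representation ℂ (GL (Fin 2) F) E}

/-- The sum of the translates by `heckeRep ϖ`; on `K`-fixed vectors this is the Hecke operator
of the double coset `K diag(ϖ, 1) K`. -/
def hecke (π : Representation ℂ (GL (Fin 2) F) V) (ϖ : Fˣ) : V →ₗ[ℂ] V :=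
  ∑ x, π (heckeRep ϖ x)

theorem hecke_apply (π : Representation ℂ (GL (Fin 2) F) V) (ϖ : Fˣ) (v : V) :
    hecke π ϖ v = ∑ x, π (heckeRep ϖ x) v :=
  LinearMap.sum_apply _ _ _

theorem map_hecke (T : E →ₗ[ℂ] V) (hT : ∀ g w, T (ρ g w) = π g (T w)) (ϖ : Fˣ) (w : E) :
    T (hecke ρ ϖ w) = hecke π ϖ (T w) := by
  simp only [hecke_apply, map_sum, hT]

theorem apply_hecke_of_fixed (hϖ : IsUniformizer ϖ) {v : V} (hv : ∀ k ∈ maxCompact F, π k v = v)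
    {k : GL (Fin 2) F} (hk : k ∈ maxCompact F) : π k (hecke π ϖ v) = hecke π ϖ v := by
  have hperm : ∀ x, ∃ y, ∃ k' ∈ maxCompact F, k * heckeRep ϖ x = heckeRep ϖ y * k' := by
    intro x
    obtain ⟨hk_int, hk_det⟩ := (mem_maxCompact_iff k).1 hk
    refine exists_eq_heckeRep_mul hϖ
      (mul_mem_integralMatrices hk_int (heckeRep_val_mem_integralMatrices hϖ x)) ?_
    rw [Units.val_mul, Matrix.det_mul, map_mul, hk_det, one_mul, det_heckeRep]
  choose σ k' hk' hσ using hperm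
  have hσ_inj : Function.Injective σ := by
    intro x y hxy
    refine eq_of_heckeRep_mul_eq_heckeRep hϖ (mul_mem (inv_mem (hk' x)) (hk' y)) ?_
    rw [← mul_right_inj k, ← mul_assoc, hσ x, hσ y, hxy]
    group
  simp only [hecke_apply, map_sum]
  refine Fintype.sum_bijective σ (Finite.injective_iff_bijective.1 hσ_inj) _ _ fun x => ?_
  rw [← Module.End.mul_apply, ← map_mul, hσ, map_mul, Module.End.mul_apply, hv _ (hk' x)]

end Hecke

section CosetAverage

variable {k G V W : Type*} [Field k] [Group G] [AddCommGroup V] [Module k V] [AddCommGroup W]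
  [Module k W] {ρ : Representation k G V} {S : Subgroup G} {v : V}

theorem apply_out_mk (hv : ∀ s ∈ S, ρ s v = v) (g : G) :
    ρ (QuotientGroup.mk g : G ⧸ S).out v = ρ g v := by
  obtain ⟨s, hs⟩ := QuotientGroup.mk_out_eq_mul S g
  rw [hs, map_mul, Module.End.mul_apply, hv s s.2]

/-- The average of the translates of `v` over `G ⧸ S`; it does not depend on the representatives
when `v` is fixed by `S`. -/
def cosetAverage (ρ : Representation k G V) (S : Subgroup G) [Fintype (G ⧸ S)] (v : V) : V :=
  (Fintype.card (G ⧸ S) : k)⁻¹ • ∑ c : G ⧸ S, ρ c.out v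

variable [Fintype (G ⧸ S)]

theorem apply_cosetAverage (hv : ∀ s ∈ S, ρ s v = v) (g : G) :
    ρ g (cosetAverage ρ S v) = cosetAverage ρ S v := by
  simp only [cosetAverage, map_smul, map_sum]
  congr 1
  refine Fintype.sum_bijective _ (MulAction.bijective g) _ _ fun c => ?_
  have hgc : g • c = QuotientGroup.mk (g * c.out) := by
    rw [← smul_eq_mul, MulAction.Quotient.coe_smul_out]
  rw [hgc, apply_out_mk hv, map_mul, Module.End.mul_apply]

theorem map_cosetAverage [CharZero k] (T : V →ₗ[k] W) (hT : ∀ g, T (ρ g v) = T v) :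
    T (cosetAverage ρ S v) = T v := by
  have hcard : (Fintype.card (G ⧸ S) : k) ≠ 0 := Nat.cast_ne_zero.2 Fintype.card_ne_zero
  simp only [cosetAverage, map_smul, map_sum, hT, Finset.sum_const, Finset.card_univ]
  rw [← Nat.cast_smul_eq_nsmul k, inv_smul_smul₀ hcard]

end CosetAverage

section Induced

variable {F : Type*} [Field F] [ValuativeRel F] [TopologicalSpace F]
  [IsNonarchimedeanLocalField F]

instance : T2Space F := by
  let := IsTopologicalAddGroup.rightUniformSpace F
  have := isUniformAddGroup_of_addCommGroup (G := F)
  infer_instance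

instance : CompactSpace (maxCompact F) := by
  have : CompactSpace (Matrix (Fin 2) (Fin 2) 𝒪[F]) :=
    inferInstanceAs (CompactSpace (Fin 2 → Fin 2 → 𝒪[F]))
  have : T1Space (Matrix (Fin 2) (Fin 2) 𝒪[F]) :=
    inferInstanceAs (T1Space (Fin 2 → Fin 2 → 𝒪[F]))
  have : CompactSpace (GL (Fin 2) 𝒪[F]) :=
    inferInstanceAs (CompactSpace (Matrix (Fin 2) (Fin 2) 𝒪[F])ˣ)
  have hcont : Continuous (GeneralLinearGroup.map (n := Fin 2) (𝒪[F]).subtype) :=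
    Continuous.generalLinearGroup_map continuous_subtype_val
  exact isCompact_iff_compactSpace.1 (isCompact_range hcont)

theorem IsSmooth.exists_fixed_forall_map_eq {E : Type*} [AddCommGroup E] [Module ℂ E]
    {ρ : Representation ℂ (GL (Fin 2) F) E} (hρ : IsSmooth ρ) (v : E) :
    ∃ w, (∀ k ∈ maxCompact F, ρ k w = w) ∧
      ∀ T : E →ₗ[ℂ] ℂ, (∀ k ∈ maxCompact F, T (ρ k v) = T v) → T w = T v := by
  obtain ⟨U, hU_open, hU⟩ := hρ v
  let S : Subgroup (maxCompact F) := U.subgroupOf (maxCompact F)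
  have : Finite (maxCompact F ⧸ S) :=
    Subgroup.quotient_finite_of_isOpen S (hU_open.preimage continuous_subtype_val)
  let := Fintype.ofFinite (maxCompact F ⧸ S)
  let ρK : Representation ℂ (maxCompact F) E := ρ.comp (maxCompact F).subtype
  have hS : ∀ s ∈ S, ρK s v = v := fun s hs => hU s (Subgroup.mem_subgroupOf.1 hs)
  exact ⟨cosetAverage ρK S v, fun k hk => apply_cosetAverage hS ⟨k, hk⟩,
    fun T hT => map_cosetAverage T fun k => hT k k.2⟩

variable {χ χ' : Fˣ →* ℂˣ} {φ : indSpace χ χ'} {ϖ : Fˣ}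

theorem isSmooth_subrepresentation_ind (N : Subrepresentation (ind χ χ')) :
    IsSmooth (V := N.toSubmodule) N.toRepresentation := by
  rintro ⟨⟨φ, -, U, hU_open, hU⟩, hN⟩
  exact ⟨U, hU_open, fun u hu => Subtype.ext (Subtype.ext (funext (hU u hu)))⟩

theorem ind_apply (g h : GL (Fin 2) F) (φ : indSpace χ χ') :
    (ind χ χ' h φ).1 g = φ.1 (g * h) := rfl

theorem ind_scalar (z : Fˣ) (φ : indSpace χ χ') :
    ind χ χ' (GeneralLinearGroup.scalar (Fin 2) z) φ = ((χ z : ℂ) * (χ' z : ℂ)) • φ := by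
  apply Subtype.ext
  funext g
  have hcomm : g * GeneralLinearGroup.scalar (Fin 2) z = unip 0 * diag z z * g := by
    rw [unip_zero, one_mul, ← scalar_eq_diag]
    ext i j
    simp [mul_comm]
  rw [ind_apply, hcomm, φ.2.1, div_self', nabsPow_eq_zpow, ord_one, zpow_zero, mul_one]
  rfl

theorem indSpace_fixed_apply (hφ : ∀ k ∈ maxCompact F, ind χ χ' k φ = φ) (x : F) (a d : Fˣ)
    {k : GL (Fin 2) F} (hk : k ∈ maxCompact F) :
    φ.1 (unip x * diag a d * k) = (χ a : ℂ) * (χ' d : ℂ) * nabsPow (a / d) (1 / 2) * φ.1 1 := by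
  rw [← ind_apply, hφ k hk, ← φ.2.1, mul_one]

theorem indSpace_fixed_ext {φ' : indSpace χ χ'} (hφ : ∀ k ∈ maxCompact F, ind χ χ' k φ = φ)
    (hφ' : ∀ k ∈ maxCompact F, ind χ χ' k φ' = φ') (h : φ.1 1 = φ'.1 1) : φ = φ' := by
  apply Subtype.ext
  funext g
  obtain ⟨x, a, d, k, hk, rfl⟩ := exists_iwasawa g
  rw [indSpace_fixed_apply hφ x a d hk, indSpace_fixed_apply hφ' x a d hk, h]

theorem indSpace_apply_heckeRep_some (hϖ : IsUniformizer ϖ) (φ : indSpace χ χ') (b : 𝓀[F]) :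
    φ.1 (heckeRep ϖ (some b)) = (χ ϖ : ℂ) * (resCard F : ℂ) ^ (-(1 / 2) : ℂ) * φ.1 1 := by
  rw [heckeRep, ← mul_one (unip _ * diag ϖ 1), φ.2.1, div_one, nabsPow_uniformizer hϖ]
  simp

theorem indSpace_apply_heckeRep_none (hϖ : IsUniformizer ϖ) (φ : indSpace χ χ') :
    φ.1 (heckeRep ϖ none) = (χ' ϖ : ℂ) * (resCard F : ℂ) ^ (1 / 2 : ℂ) * φ.1 1 := by
  have h := φ.2.1 0 1 ϖ 1
  rw [unip_zero, one_mul, mul_one, one_div, nabsPow_eq_zpow, ord_inv, ord_uniformizer hϖ] at h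
  simpa [heckeRep, Complex.cpow_neg] using h

theorem hecke_ind (hϖ : IsUniformizer ϖ) (hφ : ∀ k ∈ maxCompact F, ind χ χ' k φ = φ) :
    hecke (ind χ χ') ϖ φ =
      ((resCard F : ℂ) ^ (1 / 2 : ℂ) * ((χ ϖ : ℂ) + (χ' ϖ : ℂ))) • φ := by
  refine indSpace_fixed_ext (fun k hk => apply_hecke_of_fixed hϖ hφ hk)
    (fun k hk => by rw [map_smul, hφ k hk]) ?_
  have hcard : (Fintype.card 𝓀[F] : ℂ) = resCard F := by
    rw [resCard, Nat.card_eq_fintype_card]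
  calc (hecke (ind χ χ') ϖ φ).1 1
      = ∑ x, φ.1 (heckeRep ϖ x) := by
        simp only [hecke_apply, AddSubmonoidClass.coe_finsetSum, Finset.sum_apply, ind_apply,
          one_mul]
    _ = (χ' ϖ : ℂ) * (resCard F : ℂ) ^ (1 / 2 : ℂ) * φ.1 1 +
          resCard F * ((χ ϖ : ℂ) * (resCard F : ℂ) ^ (-(1 / 2) : ℂ) * φ.1 1) := by
        simp only [Fintype.sum_option, indSpace_apply_heckeRep_none hϖ,
          indSpace_apply_heckeRep_some hϖ, Finset.sum_const, Finset.card_univ, nsmul_eq_mul, hcard]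
    _ = (resCard F : ℂ) ^ (1 / 2 : ℂ) * ((χ ϖ : ℂ) + (χ' ϖ : ℂ)) * φ.1 1 := by
        linear_combination (χ ϖ : ℂ) * φ.1 1 * mul_cpow_neg_half (resCard F)

variable {V : Type*} [AddCommGroup V] [Module ℂ V] {π : Representation ℂ (GL (Fin 2) F) V}

theorem IsConstituentOfInd.scalar_apply (hπ : IsConstituentOfInd π χ χ') (z : Fˣ) (v : V) :
    π (GeneralLinearGroup.scalar (Fin 2) z) v = ((χ z : ℂ) * (χ' z : ℂ)) • v := by
  obtain ⟨N, p, hp⟩ := hπ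
  obtain ⟨n, rfl⟩ := hp v
  have hn : N.toRepresentation (GeneralLinearGroup.scalar (Fin 2) z) n =
      ((χ z : ℂ) * (χ' z : ℂ)) • n := Subtype.ext (ind_scalar z n.1)
  rw [← p.isIntertwining, hn, map_smul]

theorem IsSatake.isUnramifiedChar_centralChar [Nontrivial V] (hπ : IsSatake π χ χ')
    {ω : Fˣ →* ℂˣ} (hω : IsCentralChar π ω) : IsUnramifiedChar ω := by
  intro z hz
  obtain ⟨v, hv⟩ := exists_ne (0 : V)
  have h := hω z v
  rw [hπ.constituent.scalar_apply, hπ.unramified₁ z hz, hπ.unramified₂ z hz] at h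
  exact Units.ext (by simpa using (smul_left_injective ℂ hv h).symm)

theorem IsConstituentOfInd.exists_hecke_eigenvector (hπ : IsConstituentOfInd π χ χ')
    (hϖ : IsUniformizer ϖ) (l : V →ₗ[ℂ] ℂ) {v : V}
    (hl : ∀ g, ∀ k ∈ maxCompact F, l (π (g * k) v) = l (π g v)) :
    ∃ w, hecke π ϖ w = ((resCard F : ℂ) ^ (1 / 2 : ℂ) * ((χ ϖ : ℂ) + (χ' ϖ : ℂ))) • w ∧
      ∀ g, l (π g w) = l (π g v) := by
  obtain ⟨N, p, hp⟩ := hπ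
  obtain ⟨n, rfl⟩ := hp v
  obtain ⟨w, hw_fixed, hw⟩ := (isSmooth_subrepresentation_ind N).exists_fixed_forall_map_eq n
  have hw_hecke : hecke (V := N.toSubmodule) N.toRepresentation ϖ w =
      ((resCard F : ℂ) ^ (1 / 2 : ℂ) * ((χ ϖ : ℂ) + (χ' ϖ : ℂ))) • w := by
    have hmap := map_hecke (ρ := N.toRepresentation) (π := ind χ χ') N.toSubmodule.subtype
      (fun _ _ => rfl) ϖ w
    exact Subtype.ext (hmap.trans
      (hecke_ind hϖ fun k hk => congrArg Subtype.val (hw_fixed k hk)))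
  refine ⟨p w, ?_, fun g => ?_⟩
  · rw [← map_smul, ← hw_hecke]
    exact (map_hecke p.toLinearMap (p.isIntertwining _ _) ϖ w).symm
  · refine hw (l ∘ₗ π g ∘ₗ p.toLinearMap) fun k hk => ?_
    have := hl g k hk
    rw [map_mul, Module.End.mul_apply, ← p.isIntertwining] at this
    exact this

end Induced

section CompleteSymm

/-- The complete homogeneous symmetric polynomial of degree `n` in two variables. -/
def completeSymm {R : Type*} [CommSemiring R] (X Y : R) (n : ℕ) : R :=
  ∑ p ∈ Finset.HasAntidiagonal.antidiagonal n, X ^ p.1 * Y ^ p.2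

/-- The coefficient at `t ^ n`, for `n : ℤ`, of `(1 - X t)⁻¹ (1 - Y t)⁻¹`. -/
def lCoeff {R : Type*} [CommSemiring R] (X Y : R) : ℤ → R :=
  Function.extend ((↑) : ℕ → ℤ) (completeSymm X Y) 0

section CommSemiring

variable {R : Type*} [CommSemiring R] (X Y : R)

theorem completeSymm_zero : completeSymm X Y 0 = 1 := by
  simp [completeSymm]

theorem completeSymm_succ (n : ℕ) :
    completeSymm X Y (n + 1) = Y ^ (n + 1) + X * completeSymm X Y n := by
  simp only [completeSymm, Finset.Nat.sum_antidiagonal_succ, Finset.mul_sum, pow_zero, one_mul,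
    pow_succ' X, mul_assoc]

theorem completeSymm_mul_pow (t : R) (n : ℕ) :
    completeSymm X Y n * t ^ n = completeSymm (X * t) (Y * t) n := by
  rw [completeSymm, completeSymm, Finset.sum_mul]
  refine Finset.sum_congr rfl fun p hp => ?_
  rw [← Finset.HasAntidiagonal.mem_antidiagonal.1 hp, pow_add, mul_pow, mul_pow]
  ring

theorem lCoeff_natCast (n : ℕ) : lCoeff X Y n = completeSymm X Y n :=
  Nat.cast_injective.extend_apply _ _ _

theorem lCoeff_of_neg {n : ℤ} (hn : n < 0) : lCoeff X Y n = 0 :=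
  Function.extend_apply' _ _ _ fun ⟨m, hm⟩ => (hm ▸ hn).not_ge (Int.natCast_nonneg m)

end CommSemiring

theorem completeSymm_add_two {R : Type*} [CommRing R] (X Y : R) (n : ℕ) :
    completeSymm X Y (n + 2) =
      (X + Y) * completeSymm X Y (n + 1) - X * Y * completeSymm X Y n := by
  rw [completeSymm_succ X Y (n + 1)]
  linear_combination (-Y) * completeSymm_succ X Y n

theorem lCoeff_mul_zpow {k : Type*} [Field k] (X Y t : k) (n : ℤ) :
    lCoeff X Y n * t ^ n = lCoeff (X * t) (Y * t) n := by
  rcases lt_or_ge n 0 with hn | hn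
  · rw [lCoeff_of_neg _ _ hn, lCoeff_of_neg _ _ hn, zero_mul]
  · lift n to ℕ using hn
    rw [lCoeff_natCast, lCoeff_natCast, zpow_natCast, completeSymm_mul_pow]

variable {k : Type*} [NormedField k] {X Y : k}

theorem summable_norm_lCoeff (hX : ‖X‖ < 1) (hY : ‖Y‖ < 1) :
    Summable fun n => ‖lCoeff X Y n‖ := by
  have hzero (n : ℤ) (hn : n ∉ Set.range ((↑) : ℕ → ℤ)) : ‖lCoeff X Y n‖ = 0 := by
    rw [lCoeff, Function.extend_apply' _ _ _ hn, Pi.zero_apply, norm_zero]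
  rw [← Nat.cast_injective.summable_iff hzero]
  simp only [Function.comp_def, lCoeff_natCast]
  exact summable_norm_sum_mul_antidiagonal_of_summable_norm
    (summable_norm_geometric_of_norm_lt_one hX) (summable_norm_geometric_of_norm_lt_one hY)

theorem tsum_lCoeff [CompleteSpace k] (hX : ‖X‖ < 1) (hY : ‖Y‖ < 1) :
    ∑' n, lCoeff X Y n = (1 - X)⁻¹ * (1 - Y)⁻¹ := by
  rw [lCoeff, tsum_extend_zero Nat.cast_injective, ← tsum_geometric_of_norm_lt_one hX,
    ← tsum_geometric_of_norm_lt_one hY]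
  exact (tsum_mul_tsum_eq_tsum_sum_antidiagonal_of_summable_norm
    (summable_norm_geometric_of_norm_lt_one hX)
    (summable_norm_geometric_of_norm_lt_one hY)).symm

end CompleteSymm

section Whittaker

theorem nontrivial_of_mem_whittakerModel {F : Type*} [Field F] {V : Type*} [AddCommGroup V]
    [Module ℂ V] {π : Representation ℂ (GL (Fin 2) F) V} {ψ : AddChar F Circle}
    {W : GL (Fin 2) F → ℂ} (hW : W ∈ whittakerModel π ψ) : Nontrivial V := by
  obtain ⟨l, hl, -⟩ := hW
  obtain ⟨v, hv⟩ := DFunLike.ne_iff.1 hl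
  exact ⟨v, 0, fun h => hv (by simp [h])⟩

variable {F : Type*} [Field F] [ValuativeRel F] [TopologicalSpace F]
  [IsNonarchimedeanLocalField F]

/-- The properties of a normalized spherical Whittaker function with Satake parameters `X`, `Y`
that determine its values: the transformation laws and the Hecke eigenvalue equation. -/
structure IsSphericalWhittaker (ψ : AddChar F Circle) (ϖ : Fˣ) (X Y : ℂ)
    (W : GL (Fin 2) F → ℂ) : Prop where
  unip_mul : ∀ x g, W (unip x * g) = (ψ x : ℂ) * W g
  mul_maxCompact : ∀ g, ∀ k ∈ maxCompact F, W (g * k) = W g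
  apply_one : W 1 = 1
  mul_scalar : ∀ g, W (g * GeneralLinearGroup.scalar (Fin 2) ϖ) = X * Y * W g
  hecke : ∀ g, ∑ x, W (g * heckeRep ϖ x) = (resCard F : ℂ) ^ (1 / 2 : ℂ) * (X + Y) * W g

variable {ψ : AddChar F Circle} {ϖ : Fˣ} {W : GL (Fin 2) F → ℂ}

variable {V : Type*} [AddCommGroup V] [Module ℂ V] {π : Representation ℂ (GL (Fin 2) F) V}

theorem IsSatake.isSphericalWhittaker {χ χ' : Fˣ →* ℂˣ} (hπ : IsSatake π χ χ')
    (hϖ : IsUniformizer ϖ) (hW : W ∈ whittakerModel π ψ) (hW_norm : IsNormalizedSpherical W) :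
    IsSphericalWhittaker ψ ϖ (χ ϖ) (χ' ϖ) W := by
  obtain ⟨l, -, hl, v, rfl⟩ := hW
  obtain ⟨hK, h_one⟩ := hW_norm
  obtain ⟨w, hw_hecke, hw⟩ := hπ.constituent.exists_hecke_eigenvector hϖ l hK
  refine ⟨fun x g => ?_, hK, h_one, fun g => ?_, fun g => ?_⟩
  · rw [map_mul]
    exact hl x _
  · rw [map_mul, Module.End.mul_apply, hπ.constituent.scalar_apply, map_smul, map_smul,
      smul_eq_mul]
  · simp only [← hw]
    simp only [map_mul, Module.End.mul_apply]
    rw [← map_sum, ← map_sum, ← hecke_apply, hw_hecke, map_smul, map_smul, smul_eq_mul]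

namespace IsSphericalWhittaker

variable {X Y : ℂ}

theorem diag_eq_zero (hW : IsSphericalWhittaker ψ ϖ X Y W) (hψ : IsUnramifiedAddChar ψ)
    {α : Fˣ} (hα : (α : F) ∉ 𝒪[F]) : W (diag α 1) = 0 := by
  obtain ⟨x, hx, hψx⟩ : ∃ x ∈ 𝒪[F], ψ (α * x) ≠ 1 := by
    simpa using mt (hψ α).1 hα
  have h := hW.mul_maxCompact (diag α 1) _ (unip_mem_maxCompact hx)
  rw [diag_mul_unip, hW.unip_mul] at h
  by_contra hne
  exact hψx (Circle.ext (by simpa using (mul_eq_right₀ hne).1 h))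

theorem diag_eq_diag (hW : IsSphericalWhittaker ψ ϖ X Y W) {α β : Fˣ} (h : ord α = ord β) :
    W (diag α 1) = W (diag β 1) := by
  have hunit : diag (β⁻¹ * α) 1 ∈ maxCompact F :=
    diag_mem_maxCompact ((valuation_eq_one_iff _).2 (by rw [ord_mul, ord_inv, h]; ring)) (by simp)
  rw [← hW.mul_maxCompact (diag β 1) _ hunit, diag_mul, mul_inv_cancel_left, mul_one]

theorem hecke_diag (hW : IsSphericalWhittaker ψ ϖ X Y W) (hψ : IsUnramifiedAddChar ψ)
    {α : Fˣ} (hα : (α : F) ∈ 𝒪[F]) :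
    (resCard F : ℂ) * W (diag (α * ϖ) 1) + X * Y * W (diag (α * ϖ⁻¹) 1) =
      (resCard F : ℂ) ^ (1 / 2 : ℂ) * (X + Y) * W (diag α 1) := by
  have hnone : diag α 1 * heckeRep ϖ none =
      diag (α * ϖ⁻¹) 1 * GeneralLinearGroup.scalar (Fin 2) ϖ := by
    rw [scalar_eq_diag, heckeRep, diag_mul, diag_mul]
    simp
  have hsome (b : 𝓀[F]) : W (diag α 1 * heckeRep ϖ (some b)) = W (diag (α * ϖ) 1) := by
    rw [heckeRep, ← mul_assoc, diag_mul_unip, mul_assoc, hW.unip_mul, diag_mul, mul_one,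
      (hψ α).2 hα _ (resLift b).2, Circle.coe_one, one_mul]
  rw [← hW.hecke, Fintype.sum_option, hnone, hW.mul_scalar]
  simp only [hsome, Finset.sum_const, Finset.card_univ, nsmul_eq_mul]
  rw [resCard, Nat.card_eq_fintype_card, add_comm]

theorem pow_mul_diag_pow (hW : IsSphericalWhittaker ψ ϖ X Y W) (hψ : IsUnramifiedAddChar ψ)
    (hϖ : IsUniformizer ϖ) (n : ℕ) :
    ((resCard F : ℂ) ^ (1 / 2 : ℂ)) ^ n * W (diag (ϖ ^ n) 1) = completeSymm X Y n := by
  have hR := cpow_half_mul_self (resCard F)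
  have hR_ne : (resCard F : ℂ) ^ (1 / 2 : ℂ) ≠ 0 := fun h =>
    natCast_resCard_ne_zero (F := F) (by rw [← hR, h, zero_mul])
  set R := (resCard F : ℂ) ^ (1 / 2 : ℂ)
  induction n using Nat.twoStepInduction with
  | zero => simp [diag_one, hW.apply_one, completeSymm_zero]
  | one =>
    have hinv : ((1 * ϖ⁻¹ : Fˣ) : F) ∉ 𝒪[F] := fun hmem =>
      uniformizer_mul_ne_one hϖ hmem (by simp)
    have h := hW.hecke_diag hψ (α := 1) (one_mem _)
    rw [hW.diag_eq_zero hψ hinv, diag_one, hW.apply_one, one_mul] at h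
    rw [completeSymm_succ, completeSymm_zero, pow_one, pow_one]
    apply mul_left_cancel₀ hR_ne
    linear_combination h + W (diag ϖ 1) * hR
  | more n ih₀ ih₁ =>
    have hmem : ((ϖ ^ (n + 1) : Fˣ) : F) ∈ 𝒪[F] := by
      rw [Units.val_pow_eq_pow_val]
      exact pow_mem hϖ.1 _
    have h := hW.hecke_diag hψ hmem
    rw [← pow_succ, pow_succ ϖ n, mul_inv_cancel_right, ← pow_succ] at h
    rw [completeSymm_add_two, ← ih₀, ← ih₁, pow_succ, pow_succ]
    linear_combination R ^ n * h + R ^ n * W (diag (ϖ ^ (n + 2)) 1) * hR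

theorem zpow_ord_mul_diag (hW : IsSphericalWhittaker ψ ϖ X Y W) (hψ : IsUnramifiedAddChar ψ)
    (hϖ : IsUniformizer ϖ) (α : Fˣ) :
    ((resCard F : ℂ) ^ (1 / 2 : ℂ)) ^ ord α * W (diag α 1) = lCoeff X Y (ord α) := by
  rcases lt_or_ge (ord α) 0 with hα | hα
  · rw [lCoeff_of_neg _ _ hα,
      hW.diag_eq_zero hψ (mt (valuation_le_one_iff α).1 hα.not_ge), mul_zero]
  · obtain ⟨n, hn⟩ := Int.eq_ofNat_of_zero_le hα
    have hϖn : ord α = ord (ϖ ^ n) := by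
      rw [← zpow_natCast, ord_zpow, ord_uniformizer hϖ, mul_one, hn]
    rw [hW.diag_eq_diag hϖn, hn, lCoeff_natCast, zpow_natCast, hW.pow_mul_diag_pow hψ hϖ]

end IsSphericalWhittaker

end Whittaker

section UnitMeasure

theorem integral_comp_eq_tsum_of_measurePreserving_count {α ι E : Type*} [MeasurableSpace α]
    [MeasurableSpace ι] [Countable ι] [MeasurableSingletonClass ι] [NormedAddCommGroup E]
    [NormedSpace ℝ E] [CompleteSpace E] {ν : Measure α} {g : α → ι} {f : ι → E}
    (hg : MeasurePreserving g ν Measure.count) (hf : Summable fun i => ‖f i‖) :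
    ∫ x, f (g x) ∂ν = ∑' i, f i := by
  have hf_int : Integrable f Measure.count := integrable_count_iff.2 hf
  rw [← integral_map hg.measurable.aemeasurable (by rw [hg.map_eq]; exact hf_int.1), hg.map_eq,
    integral_countable hf_int]
  simp

variable {F : Type*} [Field F] [ValuativeRel F] [TopologicalSpace F]
  [IsNonarchimedeanLocalField F]

theorem continuous_ord : Continuous (ord : Fˣ → ℤ) := by
  refine continuous_discrete_rng.2 fun n => ?_
  obtain ⟨x, rfl⟩ := ord_surjective (F := F) n
  have hx : (valuation F).restrict (x : F) ≠ 0 := by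
    rw [← map_zero (valuation F).restrict, ne_eq, (valuation F).restrict_inj]
    simp
  convert (Valuation.isOpen_sphere hx).preimage Units.continuous_val using 1
  ext y
  simp only [Set.mem_preimage, Set.mem_singleton_iff, Set.mem_ofPred_eq,
    (valuation F).restrict_inj, valuation_eq_valuation_iff]

instance : SigmaCompactSpace F := by
  have : Countable (ValueGroupWithZero F) :=
    (IsNonarchimedeanLocalField.valueGroupWithZeroIsoInt F).toEquiv.countable_iff.2
      (inferInstanceAs (Countable (Option (Multiplicative ℤ))))
  exact SigmaCompactSpace.of_countable (Set.range fun γ => {x : F | valuation F x ≤ γ})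
    (Set.countable_range _)
    (Set.forall_mem_range.2 (IsNonarchimedeanLocalField.isCompact_closedBall F))
    (Set.eq_univ_of_forall fun x => ⟨_, ⟨valuation F x, rfl⟩, le_refl (valuation F x)⟩)

theorem IsUnramifiedAddChar.continuous {ψ : AddChar F Circle} (hψ : IsUnramifiedAddChar ψ) :
    Continuous ψ := by
  refine continuous_iff_continuousAt.2 fun x => ?_
  have hmem : {y : F | y - x ∈ 𝒪[F]} ∈ nhds x :=
    ((Valuation.isOpen_integer (v := valuation F)).preimage (continuous_sub_right x)).mem_nhds
      (by simp [zero_mem])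
  refine (continuousAt_const (y := ψ x)).congr (Filter.eventually_of_mem hmem fun y hy => ?_)
  have h := (hψ 1).2 (one_mem _) _ hy
  rw [one_mul, AddChar.map_sub_eq_div, div_eq_one] at h
  exact h.symm

variable [MeasurableSpace F] [BorelSpace F]

instance : BorelSpace Fˣ :=
  ⟨by rw [Units.isEmbedding_val₀.eq_induced, borel_comap, ← BorelSpace.measurable_eq (α := F)]; rfl⟩

theorem measurePreserving_ord {dt : Measure Fˣ} [dt.IsHaarMeasure]
    (hdt : dt {x : Fˣ | valuation F (x : F) = 1} = 1) :
    MeasurePreserving ord dt Measure.count := by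
  refine ⟨continuous_ord.measurable, Measure.ext_of_singleton fun n => ?_⟩
  obtain ⟨y, rfl⟩ := ord_surjective (F := F) n
  have hfiber : (y * ·) ⁻¹' (ord ⁻¹' {ord y}) = {x : Fˣ | valuation F (x : F) = 1} := by
    ext x
    simp [valuation_eq_one_iff, ord_mul]
  rw [Measure.map_apply continuous_ord.measurable (measurableSet_singleton _),
    ← measure_preimage_mul dt y, hfiber, hdt, Measure.count_singleton]

end UnitMeasure

section InnerIntegral

variable {F : Type*} [Field F] [ValuativeRel F] [TopologicalSpace F]
  [IsNonarchimedeanLocalField F]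

/-- The quasi-character `μ |·|^s`. -/
def twist (μ : Fˣ →* ℂˣ) (s : ℂ) (x : Fˣ) : ℂ :=
  (μ x : ℂ) * nabsPow x s

variable {μ : Fˣ →* ℂˣ} {ϖ : Fˣ} {s : ℂ}

theorem twist_eq_zpow (hμ : IsUnramifiedChar μ) (hϖ : IsUniformizer ϖ) (x : Fˣ) :
    twist μ s x = twist μ s ϖ ^ ord x := by
  rw [twist, twist, hμ.eq_zpow_ord hϖ x, Units.val_zpow_eq_zpow_val, nabsPow_eq_zpow x,
    nabsPow_uniformizer hϖ, mul_zpow]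

theorem sphericalL_eq_inv_mul_inv (hϖ : IsUniformizer ϖ) (χ χ' μ : Fˣ →* ℂˣ) (s : ℂ) :
    sphericalL ϖ χ χ' μ s =
      (1 - (χ ϖ : ℂ) * twist μ s ϖ)⁻¹ * (1 - (χ' ϖ : ℂ) * twist μ s ϖ)⁻¹ := by
  simp only [sphericalL, tateL, twist, nabsPow_uniformizer hϖ, MonoidHom.mul_apply, Units.val_mul,
    mul_assoc]

theorem norm_mul_twist_lt_one (hϖ : IsUniformizer ϖ) {χ : Fˣ →* ℂˣ}
    (h : ‖((χ * μ) ϖ : ℂ)‖ < (resCard F : ℝ) ^ s.re) : ‖(χ ϖ : ℂ) * twist μ s ϖ‖ < 1 := by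
  have hq : 0 < resCard F := zero_lt_one.trans one_lt_resCard
  have hq_pow : 0 < (resCard F : ℝ) ^ s.re := Real.rpow_pos_of_pos (Nat.cast_pos.2 hq) _
  rw [twist, nabsPow_uniformizer hϖ, ← mul_assoc, norm_mul, Complex.norm_natCast_cpow_of_pos hq,
    Complex.neg_re, Real.rpow_neg (Nat.cast_nonneg _), ← div_eq_mul_inv, div_lt_one hq_pow]
  simpa using h

variable {ψ : AddChar F Circle} {W : GL (Fin 2) F → ℂ} {X Y : ℂ} {k : GL (Fin 2) F}

namespace IsSphericalWhittaker

theorem innerIntegrand_eq_lCoeff_mul (hW : IsSphericalWhittaker ψ ϖ X Y W)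
    (hψ : IsUnramifiedAddChar ψ) (hϖ : IsUniformizer ϖ) (hμ : IsUnramifiedChar μ)
    (hk : k ∈ maxCompact F) (u : F) (s : ℂ) (α : Fˣ) :
    innerIntegrand ψ W k u μ s α =
      lCoeff (X * twist μ s ϖ) (Y * twist μ s ϖ) (ord α) * (ψ (u * α) : ℂ) := by
  rw [← lCoeff_mul_zpow, ← hW.zpow_ord_mul_diag hψ hϖ, ← twist_eq_zpow hμ hϖ, twist,
    innerIntegrand, hW.mul_maxCompact _ _ hk, nabsPow_sub_half]
  ring

variable [MeasurableSpace F] {dt : Measure Fˣ}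

theorem integrable_innerIntegrand [BorelSpace F] (hW : IsSphericalWhittaker ψ ϖ X Y W)
    (hψ : IsUnramifiedAddChar ψ) (hϖ : IsUniformizer ϖ) (hμ : IsUnramifiedChar μ)
    (hk : k ∈ maxCompact F) (u : F) (hdt : MeasurePreserving ord dt Measure.count)
    (hX : ‖X * twist μ s ϖ‖ < 1) (hY : ‖Y * twist μ s ϖ‖ < 1) :
    Integrable (innerIntegrand ψ W k u μ s) dt := by
  have hψ_cont : Continuous fun α : Fˣ => (ψ (u * α) : ℂ) :=
    continuous_subtype_val.comp (hψ.continuous.comp (continuous_const.mul Units.continuous_val))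
  rw [funext (hW.innerIntegrand_eq_lCoeff_mul hψ hϖ hμ hk u s)]
  have hsum := summable_norm_lCoeff hX hY
  exact (hdt.integrable_comp_of_integrable (integrable_count_iff.2 hsum)).mul_bdd (c := 1)
    hψ_cont.aestronglyMeasurable (Filter.Eventually.of_forall fun α => (Circle.norm_coe _).le)

theorem innerZeta_eq_inv_mul_inv (hW : IsSphericalWhittaker ψ ϖ X Y W) (hψ : IsUnramifiedAddChar ψ)
    (hϖ : IsUniformizer ϖ) (hμ : IsUnramifiedChar μ) (hk : k ∈ maxCompact F) {u : F}
    (hu : u ∈ 𝒪[F]) (hdt : MeasurePreserving ord dt Measure.count)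
    (hX : ‖X * twist μ s ϖ‖ < 1) (hY : ‖Y * twist μ s ϖ‖ < 1) :
    innerZeta dt ψ W k u μ s = (1 - X * twist μ s ϖ)⁻¹ * (1 - Y * twist μ s ϖ)⁻¹ := by
  have hint (α : Fˣ) : innerIntegrand ψ W k u μ s α =
      lCoeff (X * twist μ s ϖ) (Y * twist μ s ϖ) (ord α) := by
    rw [hW.innerIntegrand_eq_lCoeff_mul hψ hϖ hμ hk u s]
    rcases lt_or_ge (ord α) 0 with hα | hα
    · rw [lCoeff_of_neg _ _ hα, zero_mul]
    · rw [(hψ u).2 hu _ ((valuation_le_one_iff α).2 hα), Circle.coe_one, mul_one]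
  have hsum := summable_norm_lCoeff hX hY
  rw [innerZeta, funext hint, integral_comp_eq_tsum_of_measurePreserving_count hdt hsum,
    tsum_lCoeff hX hY]

end IsSphericalWhittaker

end InnerIntegral

section OuterIntegral

variable {F : Type*} [Field F] [ValuativeRel F]

variable (F) in
/-- The set of `(u, v, ε, k₁, k₂)` with `u, v ∈ 𝒪` and `ε ∈ 𝒪ˣ`: the support of the zeta integrand
for the characteristic function of `M₂(𝒪) × M₂(𝒪)`. -/
def zetaSupport : Set (F × F × Fˣ × maxCompact F × maxCompact F) :=
  (𝒪[F] : Set F) ×ˢ (𝒪[F] : Set F) ×ˢ {x : Fˣ | valuation F (x : F) = 1} ×ˢ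
    (Set.univ : Set (maxCompact F)) ×ˢ (Set.univ : Set (maxCompact F))

theorem mul_mem_integer_iff_of_valuation_eq_one {a x : F} (ha : valuation F a = 1) :
    a * x ∈ 𝒪[F] ↔ x ∈ 𝒪[F] := by
  rw [Valuation.mem_integer_iff, Valuation.mem_integer_iff, map_mul, ha, one_mul]

theorem valuation_eq_one_iff_mem_integer (ε : Fˣ) :
    valuation F (ε : F) = 1 ↔ ((ε⁻¹ : Fˣ) : F) ∈ 𝒪[F] ∧ (ε : F) ∈ 𝒪[F] := by
  rw [Valuation.mem_integer_iff, Valuation.mem_integer_iff, Units.val_inv_eq_inv_val, map_inv₀,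
    inv_le_one₀ (zero_lt_iff.2 ((valuation F).ne_zero_iff.2 ε.ne_zero)), and_comm,
    ← le_antisymm_iff]

theorem mem_integralMatrices_and_mem_iff (u v : F) (ε : Fˣ) :
    (!![((ε⁻¹ : Fˣ) : F), ((ε⁻¹ : Fˣ) : F) * v; 0, 0] ∈ integralMatrices F ∧
      !![0, -(u * (ε : F)); 0, (ε : F)] ∈ integralMatrices F) ↔
    u ∈ 𝒪[F] ∧ v ∈ 𝒪[F] ∧ valuation F (ε : F) = 1 := by
  have hentries (hε : valuation F (ε : F) = 1) :
      (((ε⁻¹ : Fˣ) : F) * v ∈ 𝒪[F] ↔ v ∈ 𝒪[F]) ∧ (-(u * (ε : F)) ∈ 𝒪[F] ↔ u ∈ 𝒪[F]) := by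
    rw [neg_mem_iff, mul_comm u, mul_mem_integer_iff_of_valuation_eq_one hε,
      mul_mem_integer_iff_of_valuation_eq_one (by simp [hε])]
    exact ⟨Iff.rfl, Iff.rfl⟩
  rw [of_mem_integralMatrices_iff, of_mem_integralMatrices_iff]
  have hunit := valuation_eq_one_iff_mem_integer ε
  have hzero := zero_mem 𝒪[F]
  tauto

theorem charFun_conj {k k' : GL (Fin 2) F} (hk : k ∈ maxCompact F) (hk' : k' ∈ maxCompact F)
    (A B : Matrix (Fin 2) (Fin 2) F) :
    charFun F (k.val * A * k'.val, k.val * B * k'.val) = charFun F (A, B) := by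
  classical
  simp only [charFun, Set.indicator_apply, Set.mem_prod, conj_mem_integralMatrices_iff hk hk',
    Pi.one_apply]

theorem zetaMeasure_zetaSupport [MeasurableSpace F] [MeasurableSpace (GL (Fin 2) F)]
    {dx : Measure F} [SFinite dx] (hdx : dx (𝒪[F] : Set F) = 1)
    {dt : Measure Fˣ} [SFinite dt] (hdt : dt {x : Fˣ | valuation F (x : F) = 1} = 1)
    (dk : Measure (maxCompact F)) [IsProbabilityMeasure dk] :
    zetaMeasure dx dt dk (zetaSupport F) = 1 := by
  simp only [zetaMeasure, zetaSupport, Measure.prod_prod, hdx, hdt, measure_univ, mul_one]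

variable [TopologicalSpace F] [IsNonarchimedeanLocalField F] [MeasurableSpace F]

theorem measurableSet_zetaSupport [BorelSpace F] [MeasurableSpace (GL (Fin 2) F)] :
    MeasurableSet (zetaSupport F) := by
  have hO : MeasurableSet (𝒪[F] : Set F) :=
    (Valuation.isOpen_integer (v := valuation F)).measurableSet
  have hU : MeasurableSet {x : Fˣ | valuation F (x : F) = 1} := by
    simp only [valuation_eq_one_iff]
    exact continuous_ord.measurable (measurableSet_singleton 0)
  exact hO.prod (hO.prod (hU.prod (MeasurableSet.univ.prod MeasurableSet.univ)))

variable {dt : Measure Fˣ} {ψ : AddChar F Circle} {W₁ W₂ : GL (Fin 2) F → ℂ} {ω₂ μ : Fˣ →* ℂˣ}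
  {s₁ s₂ L₁ L₂ : ℂ}

theorem zetaIntegrand_eq_indicator (hω₂ : IsUnramifiedChar ω₂)
    (h₁ : ∀ k ∈ maxCompact F, ∀ u ∈ 𝒪[F], innerZeta dt ψ W₁ k u μ s₁ = L₁)
    (h₂ : ∀ k ∈ maxCompact F, ∀ v ∈ 𝒪[F], innerZeta dt ψ W₂ k v μ⁻¹ s₂ = L₂) :
    zetaIntegrand dt ψ W₁ W₂ (charFun F) ω₂ μ s₁ s₂ =
      (zetaSupport F).indicator fun _ => L₁ * L₂ := by
  classical
  funext ⟨u, v, ε, k₁, k₂⟩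
  have hmem : (u, v, ε, k₁, k₂) ∈ zetaSupport F ↔
      u ∈ 𝒪[F] ∧ v ∈ 𝒪[F] ∧ valuation F (ε : F) = 1 := by
    simp [zetaSupport]
  rw [zetaIntegrand, charFun_conj (k₁⁻¹).2 k₂.2]
  simp only [charFun, Set.indicator_apply, Set.mem_prod, mem_integralMatrices_and_mem_iff, hmem]
  split_ifs with h
  · obtain ⟨hu, hv, hε⟩ := h
    rw [hω₂ ε hε, h₁ _ k₁.2 u hu, h₂ _ k₂.2 v hv, nabsPow_eq_zpow, (valuation_eq_one_iff ε).1 hε]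
    simp
  · simp only [zero_mul]

variable [BorelSpace F] [MeasurableSpace (GL (Fin 2) F)] {dx : Measure F} [SFinite dx] [SFinite dt]

theorem integrable_zetaIntegrand (hdx : dx (𝒪[F] : Set F) = 1)
    (hdt : dt {x : Fˣ | valuation F (x : F) = 1} = 1)
    (dk : Measure (maxCompact F)) [IsProbabilityMeasure dk] (hω₂ : IsUnramifiedChar ω₂)
    (h₁ : ∀ k ∈ maxCompact F, ∀ u ∈ 𝒪[F], innerZeta dt ψ W₁ k u μ s₁ = L₁)
    (h₂ : ∀ k ∈ maxCompact F, ∀ v ∈ 𝒪[F], innerZeta dt ψ W₂ k v μ⁻¹ s₂ = L₂) :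
    Integrable (zetaIntegrand dt ψ W₁ W₂ (charFun F) ω₂ μ s₁ s₂) (zetaMeasure dx dt dk) := by
  rw [zetaIntegrand_eq_indicator hω₂ h₁ h₂, integrable_indicator_iff measurableSet_zetaSupport]
  exact integrableOn_const (by simp [zetaMeasure_zetaSupport hdx hdt dk])

theorem zetaIntegral_eq_mul (hdx : dx (𝒪[F] : Set F) = 1)
    (hdt : dt {x : Fˣ | valuation F (x : F) = 1} = 1)
    (dk : Measure (maxCompact F)) [IsProbabilityMeasure dk] (hω₂ : IsUnramifiedChar ω₂)
    (h₁ : ∀ k ∈ maxCompact F, ∀ u ∈ 𝒪[F], innerZeta dt ψ W₁ k u μ s₁ = L₁)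
    (h₂ : ∀ k ∈ maxCompact F, ∀ v ∈ 𝒪[F], innerZeta dt ψ W₂ k v μ⁻¹ s₂ = L₂) :
    zetaIntegral dx dt dk ψ W₁ W₂ (charFun F) ω₂ μ s₁ s₂ = L₁ * L₂ := by
  rw [zetaIntegral, zetaIntegrand_eq_indicator hω₂ h₁ h₂,
    integral_indicator_const _ measurableSet_zetaSupport, Measure.real,
    zetaMeasure_zetaSupport hdx hdt dk, ENNReal.toReal_one, one_smul]

end OuterIntegral

end LocalGL2

end

theorem mainTheorem8_general
    {F : Type*} [Field F] [ValuativeRel F] [TopologicalSpace F] [IsNonarchimedeanLocalField F]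
    [MeasurableSpace F] [BorelSpace F] [MeasurableSpace (GL (Fin 2) F)]
    (dx : Measure F) [dx.IsAddHaarMeasure] (hdx : dx (𝒪[F] : Set F) = 1)
    (dt : Measure Fˣ) [dt.IsHaarMeasure] (hdt : dt {x : Fˣ | valuation F (x : F) = 1} = 1)
    (dk : Measure (maxCompact F)) [IsProbabilityMeasure dk]
    {ϖ : Fˣ} (hϖ : IsUniformizer ϖ) {ψ : AddChar F Circle} (hψ : IsUnramifiedAddChar ψ)
    {V₁ V₂ : Type*} [AddCommGroup V₁] [Module ℂ V₁] [AddCommGroup V₂] [Module ℂ V₂]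
    {π₁ : Representation ℂ (GL (Fin 2) F) V₁} {π₂ : Representation ℂ (GL (Fin 2) F) V₂}
    {χ₁ χ₁' χ₂ χ₂' : Fˣ →* ℂˣ} (hχ₁ : IsSatake π₁ χ₁ χ₁') (hχ₂ : IsSatake π₂ χ₂ χ₂')
    {ω₂ : Fˣ →* ℂˣ} (hω₂ : IsCentralChar π₂ ω₂) {W₁ W₂ : GL (Fin 2) F → ℂ}
    (hW₁ : W₁ ∈ whittakerModel π₁ ψ) (hW₂ : W₂ ∈ whittakerModel π₂ ψ)
    (hK₁ : IsNormalizedSpherical W₁) (hK₂ : IsNormalizedSpherical W₂)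
    {μ : Fˣ →* ℂˣ} (hμ : IsUnramifiedChar μ) {s₁ s₂ : ℂ}
    (hs₁ : ‖((χ₁ * μ) ϖ : ℂ)‖ < (resCard F : ℝ) ^ s₁.re)
    (hs₁' : ‖((χ₁' * μ) ϖ : ℂ)‖ < (resCard F : ℝ) ^ s₁.re)
    (hs₂ : ‖((χ₂ * μ⁻¹) ϖ : ℂ)‖ < (resCard F : ℝ) ^ s₂.re)
    (hs₂' : ‖((χ₂' * μ⁻¹) ϖ : ℂ)‖ < (resCard F : ℝ) ^ s₂.re) :
    ZetaConverges dx dt dk ψ W₁ W₂ (charFun F) ω₂ μ s₁ s₂ ∧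
    zetaIntegral dx dt dk ψ W₁ W₂ (charFun F) ω₂ μ s₁ s₂ =
      sphericalL ϖ χ₁ χ₁' μ s₁ * sphericalL ϖ χ₂ χ₂' μ⁻¹ s₂ := by
  have hord := measurePreserving_ord hdt
  have := hord.sigmaFinite
  have := nontrivial_of_mem_whittakerModel hW₂
  have hω₂_unr := hχ₂.isUnramifiedChar_centralChar hω₂
  have hw₁ := hχ₁.isSphericalWhittaker hϖ hW₁ hK₁
  have hw₂ := hχ₂.isSphericalWhittaker hϖ hW₂ hK₂
  have hX₁ := norm_mul_twist_lt_one hϖ hs₁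
  have hY₁ := norm_mul_twist_lt_one hϖ hs₁'
  have hX₂ := norm_mul_twist_lt_one hϖ hs₂
  have hY₂ := norm_mul_twist_lt_one hϖ hs₂'
  have hL₁ : ∀ k ∈ maxCompact F, ∀ u ∈ 𝒪[F],
      innerZeta dt ψ W₁ k u μ s₁ = sphericalL ϖ χ₁ χ₁' μ s₁ := fun k hk u hu =>
    (hw₁.innerZeta_eq_inv_mul_inv hψ hϖ hμ hk hu hord hX₁ hY₁).trans
      (sphericalL_eq_inv_mul_inv hϖ _ _ _ _).symm
  have hL₂ : ∀ k ∈ maxCompact F, ∀ v ∈ 𝒪[F],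
      innerZeta dt ψ W₂ k v μ⁻¹ s₂ = sphericalL ϖ χ₂ χ₂' μ⁻¹ s₂ := fun k hk v hv =>
    (hw₂.innerZeta_eq_inv_mul_inv hψ hϖ hμ.inv hk hv hord hX₂ hY₂).trans
      (sphericalL_eq_inv_mul_inv hϖ _ _ _ _).symm
  exact ⟨⟨fun k hk u => hw₁.integrable_innerIntegrand hψ hϖ hμ hk u hord hX₁ hY₁,
    fun k hk v => hw₂.integrable_innerIntegrand hψ hϖ hμ.inv hk v hord hX₂ hY₂,
    integrable_zetaIntegrand hdx hdt dk hω₂_unr hL₁ hL₂⟩,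
    zetaIntegral_eq_mul hdx hdt dk hω₂_unr hL₁ hL₂⟩

theorem mainTheorem8
    {F : Type*} [Field F] [ValuativeRel F] [TopologicalSpace F] [IsNonarchimedeanLocalField F]
    [MeasurableSpace F] [BorelSpace F]
    [MeasurableSpace (GL (Fin 2) F)] [BorelSpace (GL (Fin 2) F)]
    -- normalized Haar measures on `F`, `Fˣ` and `K`
    (dx : Measure F) [dx.IsAddHaarMeasure] (hdx : dx (𝒪[F] : Set F) = 1)
    (dt : Measure Fˣ) [dt.IsHaarMeasure] (hdt : dt {x : Fˣ | valuation F (x : F) = 1} = 1)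
    (dk : Measure (maxCompact F)) [dk.IsHaarMeasure] (hdk : dk Set.univ = 1)
    (ϖ : Fˣ) (hϖ : IsUniformizer ϖ)
    (ψ : AddChar F Circle) (hψ : IsUnramifiedAddChar ψ)
    {V₁ V₂ : Type*} [AddCommGroup V₁] [Module ℂ V₁] [AddCommGroup V₂] [Module ℂ V₂]
    (π₁ : Representation ℂ (GL (Fin 2) F) V₁) (π₂ : Representation ℂ (GL (Fin 2) F) V₂)
    (hπ₁ : IsSpherical π₁) (hπ₂ : IsSpherical π₂)
    -- Satake parameters of `π₁` and `π₂`
    (χ₁ χ₁' χ₂ χ₂' : Fˣ →* ℂˣ) (hχ₁ : IsSatake π₁ χ₁ χ₁') (hχ₂ : IsSatake π₂ χ₂ χ₂')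
    (ω₁ ω₂ : Fˣ →* ℂˣ) (hω₁ : IsCentralChar π₁ ω₁) (hω₂ : IsCentralChar π₂ ω₂)
    (hω : ω₁ * ω₂ = 1)
    (W₁ W₂ : GL (Fin 2) F → ℂ)
    (hW₁ : W₁ ∈ whittakerModel π₁ ψ) (hW₂ : W₂ ∈ whittakerModel π₂ ψ)
    (hK₁ : IsNormalizedSpherical W₁) (hK₂ : IsNormalizedSpherical W₂)
    (μ : Fˣ →* ℂˣ) (hμ : IsUnramifiedChar μ)
    (s₁ s₂ : ℂ)
    -- the half-planes to the right of the poles of `L(s, π₁, μ)` and of `L(s, π₂, μ⁻¹)`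
    (hs₁ : ‖((χ₁ * μ) ϖ : ℂ)‖ < (resCard F : ℝ) ^ s₁.re)
    (hs₁' : ‖((χ₁' * μ) ϖ : ℂ)‖ < (resCard F : ℝ) ^ s₁.re)
    (hs₂ : ‖((χ₂ * μ⁻¹) ϖ : ℂ)‖ < (resCard F : ℝ) ^ s₂.re)
    (hs₂' : ‖((χ₂' * μ⁻¹) ϖ : ℂ)‖ < (resCard F : ℝ) ^ s₂.re) :
    ZetaConverges dx dt dk ψ W₁ W₂ (charFun F) ω₂ μ s₁ s₂ ∧
    zetaIntegral dx dt dk ψ W₁ W₂ (charFun F) ω₂ μ s₁ s₂ =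
      sphericalL ϖ χ₁ χ₁' μ s₁ * sphericalL ϖ χ₂ χ₂' μ⁻¹ s₂ := by
  have : IsProbabilityMeasure dk := ⟨hdk⟩
  exact mainTheorem8_general dx hdx dt hdt dk hϖ hψ hχ₁ hχ₂ hω₂ hW₁ hW₂ hK₁ hK₂ hμ
    hs₁ hs₁' hs₂ hs₂'
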